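/- Let $n\ge 2$, let $M$ be a closed (compact, without boundary, non-empty) smooth $n$-manifold, $T>0$, and let $g=g(t)$, $f=f(\cdot,t)$, $t\in[0,T]$, be a time-dependent Riemannian metric and potential of class $C^2$ on $M\times[0,T]$. Let $s\ge 2$, let $m\ge n$ be real (if $m=n$, then $f(\cdot,t)$ is constant on $M$ for each $t$), let $k,a\in\mathbb R$, and let $$1<p\le 1+\frac{1}{\sqrt{(s-1)(m-1)}} .$$ Write $\Delta_f w=\Delta w-\langle\nabla f,\nabla w\rangle$ and $$\mathrm{Ric}_f^m=\mathrm{Ric}(g)+\nabla\nabla f-\frac{\nabla f\otimes\nabla f}{m-n}$$ (the last term being absent when $m=n$), all operators, norms and inner products being those of $g(t)$. Let $\mathscr N=\mathscr N(t,x,u)$ be real-valued and, for each $t\in(0,T]$, of class $C^1$ in $(x,u)\in M\times(0,\infty)$. Let $u$ be a positive $C^\infty$ function on $M\times[0,T]$ solving $$\partial_t u-\Delta_f u^p=\mathscr N(t,x,u)\quad\text{on } M\times(0,T],$$ and put $$v=\frac{p\,u^{p-1}}{p-1},\qquad \Sigma(t,x,v)=p\Big[\tfrac{(p-1)v}{p}\Big]^{\frac{p-2}{p-1}}\mathscr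 N\Big(t,x,\Big[\tfrac{(p-1)v}{p}\Big]^{\frac1{p-1}}\Big).$$ Assume the super flow inequality $$\tfrac12\,\partial_t g(x,t)+(p-1)\,v(x,t)\,\mathrm{Ric}_f^m(g)(x,t)\ \ge\ -k\,g(x,t)\quad\text{on } M\times(0,T].$$ Let $\Gamma\in C^2((0,\infty))$ and suppose that for all $x\in M$ and $0<t\le T$, with $v=v(x,t)$, * $\Gamma'(v)\,\Sigma(t,x,v)\le 0$; * $\Gamma'(v)+v\,\Gamma''(v)\ge 0$; * $\langle\nabla v,\Sigma_x(t,x,v)\rangle\le 0$, where $\Sigma_x$ is the gradient of $\Sigma$ in $x$ with $t$ and $v$ frozen; * $\Sigma_v(t,x,v)+\dfrac{\Sigma(t,x,v)}{2(s-1)(p-1)v}\le a$. Then the maximum below is attained and, for all $x\in M$ and $0<t\le T$, $$\Big[v^{\frac{s}{2(s-1)(p-1)}}|\nabla v|^s\Big](x,t)\le e^{s(k+a)t}\Big\{\max_{M}\Big[v^{\frac{s}{2(s-1)(p-1)}}|\nabla v|^s+\Gamma(v)\Big]_{t=0}-\Gamma(v(x,t))\Big\}.$$ -/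

import Mathlib

open scoped Manifold ContDiff

noncomputable section

namespace PME

variable {n : ℕ} {M : Type*} [TopologicalSpace M] [ChartedSpace (EuclideanSpace ℝ (Fin n)) M]

/-- A Riemannian metric on the `n`-manifold `M` (at a fixed time): an inner product on every
tangent space. Its regularity is required separately, jointly with time. -/
abbrev Metric (n : ℕ) (M : Type*) [TopologicalSpace M]
    [ChartedSpace (EuclideanSpace ℝ (Fin n)) M] :=
  Bundle.RiemannianMetric (fun x : M => TangentSpace (𝓡 n) x)

/-- The inner product `g_x` as a bilinear form on `T_x M`. -/
def metricForm (g : Metric n M) (x : M) : LinearMap.BilinForm ℝ (TangentSpace (𝓡 n) x) :=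
  LinearMap.mk₂ ℝ (fun X Y => g.inner x X Y) (by simp) (by simp) (by simp) (by simp)

theorem metricForm_nondegenerate (g : Metric n M) (x : M) : (metricForm g x).Nondegenerate := by
  constructor
  · intro X hX
    by_contra h
    exact (g.pos x X h).ne' (hX X)
  · intro X hX
    by_contra h
    exact (g.pos x X h).ne' (hX X)

instance (x : M) : FiniteDimensional ℝ (TangentSpace (𝓡 n) x) :=
  inferInstanceAs (FiniteDimensional ℝ (EuclideanSpace ℝ (Fin n)))

/-- The differential `dw_x` of a real function, as a linear form on `T_x M`. -/
def differential (w : M → ℝ) (x : M) : Module.Dual ℝ (TangentSpace (𝓡 n) x) :=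
  (mfderiv (𝓡 n) 𝓘(ℝ, ℝ) w x : TangentSpace (𝓡 n) x →L[ℝ] ℝ).toLinearMap

/-- The gradient `∇w(x)`: the vector representing `dw_x` with respect to `g_x`. -/
def gradient (g : Metric n M) (w : M → ℝ) (x : M) : TangentSpace (𝓡 n) x :=
  ((metricForm g x).toDual (metricForm_nondegenerate g x)).symm (differential w x)

theorem inner_gradient (g : Metric n M) (w : M → ℝ) (x : M) (X : TangentSpace (𝓡 n) x) :
    g.inner x (gradient g w x) X = differential w x X :=
  LinearMap.BilinForm.apply_toDual_symm_apply (hB := metricForm_nondegenerate g x) _ X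

/-- `⟨∇w, ∇z⟩` at `x`. -/
def gradInner (g : Metric n M) (w z : M → ℝ) (x : M) : ℝ :=
  g.inner x (gradient g w x) (gradient g z x)

/-- `|∇w|` at `x`. -/
def gradNorm (g : Metric n M) (w : M → ℝ) (x : M) : ℝ :=
  Real.sqrt (gradInner g w w x)

/-! ### Local coordinates

`φ` is a chart and `y` a point of `φ.target`; tensor components are functions of `y`. -/

/-- The partial derivative `∂F/∂x_i` of a function on coordinate space. -/
def partialD (i : Fin n) (F : EuclideanSpace ℝ (Fin n) → ℝ) (y : EuclideanSpace ℝ (Fin n)) : ℝ :=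
  fderiv ℝ F y (EuclideanSpace.single i 1)

/-- The coordinate vector field `∂/∂x_i` at the point with coordinates `y`. -/
def coordVector (φ : OpenPartialHomeomorph M (EuclideanSpace ℝ (Fin n))) (i : Fin n)
    (y : EuclideanSpace ℝ (Fin n)) : TangentSpace (𝓡 n) (φ.symm y) :=
  mfderiv (𝓡 n) (𝓡 n) φ.symm y (EuclideanSpace.single i (1 : ℝ) : EuclideanSpace ℝ (Fin n))

/-- `g_ij`. -/
def metricComp (g : Metric n M) (φ : OpenPartialHomeomorph M (EuclideanSpace ℝ (Fin n)))
    (i j : Fin n) (y : EuclideanSpace ℝ (Fin n)) : ℝ :=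
  g.inner (φ.symm y) (coordVector φ i y) (coordVector φ j y)

/-- `g^ij`, the entries of the inverse matrix. -/
def metricInv (g : Metric n M) (φ : OpenPartialHomeomorph M (EuclideanSpace ℝ (Fin n)))
    (i j : Fin n) (y : EuclideanSpace ℝ (Fin n)) : ℝ :=
  (Matrix.of fun a b => metricComp g φ a b y)⁻¹ i j

/-- The Christoffel symbol `Γ^k_ij`. -/
def christoffel (g : Metric n M) (φ : OpenPartialHomeomorph M (EuclideanSpace ℝ (Fin n)))
    (k i j : Fin n) (y : EuclideanSpace ℝ (Fin n)) : ℝ :=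
  ∑ l, metricInv g φ k l y / 2 *
    (partialD i (metricComp g φ j l) y + partialD j (metricComp g φ i l) y
      - partialD l (metricComp g φ i j) y)

/-- The Ricci curvature component `[Ric(g)]_ij`. -/
def ricci (g : Metric n M) (φ : OpenPartialHomeomorph M (EuclideanSpace ℝ (Fin n)))
    (i j : Fin n) (y : EuclideanSpace ℝ (Fin n)) : ℝ :=
  ∑ k, partialD k (christoffel g φ k i j) y - ∑ l, partialD i (christoffel g φ l l j) y
    + ∑ k, ∑ l, (christoffel g φ k i j y * christoffel g φ l l k y
        - christoffel g φ l i k y * christoffel g φ k l j y)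

/-- The Hessian component `[∇∇w]_ij = ∂_i ∂_j w - Γ^k_ij ∂_k w`. -/
def hessian (g : Metric n M) (φ : OpenPartialHomeomorph M (EuclideanSpace ℝ (Fin n)))
    (w : M → ℝ) (i j : Fin n) (y : EuclideanSpace ℝ (Fin n)) : ℝ :=
  partialD i (partialD j (w ∘ φ.symm)) y
    - ∑ k, christoffel g φ k i j y * partialD k (w ∘ φ.symm) y

/-- The component of the Bakry-Émery tensor
`Ric_f^m(g) = Ric(g) + ∇∇f - (∇f ⊗ ∇f) / (m - n)`.
For `m = n` the last term is `0` by the convention on division by zero; there `f` is only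
allowed to be constant. -/
def bakryEmery (m : ℝ) (g : Metric n M) (f : M → ℝ)
    (φ : OpenPartialHomeomorph M (EuclideanSpace ℝ (Fin n)))
    (i j : Fin n) (y : EuclideanSpace ℝ (Fin n)) : ℝ :=
  ricci g φ i j y + hessian g φ f i j y
    - partialD i (f ∘ φ.symm) y * partialD j (f ∘ φ.symm) y / (m - n)

/-- The Laplacian `Δw`, the trace of the Hessian, computed at `x` in the chart `φ`. -/
def laplacian (g : Metric n M) (φ : OpenPartialHomeomorph M (EuclideanSpace ℝ (Fin n)))
    (w : M → ℝ) (x : M) : ℝ :=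
  ∑ i, ∑ j, metricInv g φ i j (φ x) * hessian g φ w i j (φ x)

/-- The `f`-Laplacian `Δ_f w = Δw - ⟨∇f, ∇w⟩`, computed at `x` in the chart `φ`. -/
def fLaplacian (g : Metric n M) (f : M → ℝ)
    (φ : OpenPartialHomeomorph M (EuclideanSpace ℝ (Fin n))) (w : M → ℝ) (x : M) : ℝ :=
  laplacian g φ w x - gradInner g f w x

/-! ### Time dependence -/

/-- The time dependent metric `g` is of class `C²` jointly in `(t, x) ∈ [0, T] × M`. -/
def MetricC2 (T : ℝ) (g : ℝ → Metric n M) : Prop :=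
  ∀ φ ∈ IsManifold.maximalAtlas (𝓡 n) ∞ M, ∀ i j : Fin n,
    ContDiffOn ℝ 2
      (fun q : ℝ × EuclideanSpace ℝ (Fin n) => metricComp (g q.1) φ i j q.2)
      (Set.Icc 0 T ×ˢ φ.target)

/-- The real function `w` is of class `C^r` jointly in `(t, x) ∈ [0, T] × M`. -/
def SpaceTimeContMDiff (n : ℕ) {M : Type*} [TopologicalSpace M]
    [ChartedSpace (EuclideanSpace ℝ (Fin n)) M] (r : WithTop ℕ∞) (T : ℝ)
    (w : ℝ → M → ℝ) : Prop :=
  ContMDiffOn (𝓘(ℝ, ℝ).prod (𝓡 n)) 𝓘(ℝ, ℝ) r (fun q : ℝ × M => w q.1 q.2)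
    (Set.Icc 0 T ×ˢ Set.univ)

/-- `u` solves `∂_t u - Δ_f u^p = N(t, x, u)` on `M × (0, T]`, in all local coordinates
(`Δ_f` being invariant under changes of coordinates). -/
def IsSolution (p T : ℝ) (g : ℝ → Metric n M) (f : ℝ → M → ℝ)
    (N : ℝ → M → ℝ → ℝ) (u : ℝ → M → ℝ) : Prop :=
  ∀ φ ∈ IsManifold.maximalAtlas (𝓡 n) ∞ M, ∀ x ∈ φ.source, ∀ t ∈ Set.Ioc 0 T,
    derivWithin (fun τ => u τ x) (Set.Icc 0 T) t
        - fLaplacian (g t) (f t) φ (fun y => u t y ^ p) x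
      = N t x (u t x)

/-- The pressure `v = p u^(p-1) / (p-1)`. -/
def pressure (p : ℝ) (u : ℝ → M → ℝ) (t : ℝ) (x : M) : ℝ :=
  p * u t x ^ (p - 1) / (p - 1)

/-- `Σ(t,x,v) = p [(p-1)v/p]^((p-2)/(p-1)) N(t, x, [(p-1)v/p]^(1/(p-1)))`. -/
def Sigma (p : ℝ) (N : ℝ → M → ℝ → ℝ) (t : ℝ) (x : M) (v : ℝ) : ℝ :=
  p * ((p - 1) * v / p) ^ ((p - 2) / (p - 1)) * N t x (((p - 1) * v / p) ^ (1 / (p - 1)))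

/-- The super flow inequality `½ ∂_t g + (p-1) v Ric_f^m(g) ≥ - k g` on `M × (0, T]`, as an
inequality of quadratic forms in all local coordinates. -/
def SuperFlow (p m k T : ℝ) (g : ℝ → Metric n M) (f v : ℝ → M → ℝ) : Prop :=
  ∀ φ ∈ IsManifold.maximalAtlas (𝓡 n) ∞ M, ∀ x ∈ φ.source, ∀ t ∈ Set.Ioc 0 T,
    ∀ ξ : Fin n → ℝ,
      -k * ∑ i, ∑ j, metricComp (g t) φ i j (φ x) * ξ i * ξ j
        ≤ ∑ i, ∑ j,
            (1 / 2 * derivWithin (fun τ => metricComp (g τ) φ i j (φ x)) (Set.Icc 0 T) t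
              + (p - 1) * v t x * bakryEmery m (g t) (f t) φ i j (φ x)) * ξ i * ξ j

/-- `v^(s/(2(s-1)(p-1))) |∇v|^s` at `(x, t)`. -/
def weightedGrad (p s : ℝ) (g : ℝ → Metric n M) (v : ℝ → M → ℝ) (t : ℝ) (x : M) : ℝ :=
  v t x ^ (s / (2 * (s - 1) * (p - 1))) * gradNorm (g t) (v t) x ^ s

end PME

end

/-! Write `q = p - 1`, `P = |∇v|²`, `β = s / (2(s-1)q)`, `κ = s(k+a)`. The pressure satisfies `∂_t v
= q v Δ_f v + P + Σ`, and the estimate says that `H = e^(-κt) v^β P^(s/2) + Γ(v)` never exceeds its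
initial maximum. By a maximum principle on the compact manifold (`le_of_hasDerivAt_nonpos_at_max`)
it is enough that `∂_t H ≤ 0` at every spatial maximum of `H(·,t)` with `0 < t < T`; this is
`exists_hasDerivAt_profile_nonpos`.

At a spatial maximum where `∇v ≠ 0`, the equation `∇H = 0` makes `∇P` a multiple `2λ∇v` of `∇v`.
Hence `∇v` is an eigenvector of the Hessian of `v` with eigenvalue `λ`, and `Γ'(v)` is expressed
through `λ`. The condition `Δ_f H ≤ 0` bounds the second order terms of `∂_t H`. The evolution of
`P` comes from the Bochner formula; the term `½ ∂_t g + q v Ric_f^m`, tested on `∇v`, is absorbed by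
the super flow inequality (`deriv_coordGradInner_le`). What this leaves is `-q v (|∇∇v|² +
⟨∇f,∇v⟩²/(m-n))`, and knowing one eigenvector improves the trace inequality to the lower bound `λ² +
(Δ_f v - λ)²/(m-1)` for the bracket (`hessian_norm_sq_ge`).

After the hypotheses on `Γ` and `Σ` are inserted there remains a quadratic form in `P`, `λ v` and
`v(Δ_f v - λ)`. Completing squares shows that it is nonpositive when `q²(s-1)(m-1) ≤ 1`, which is
the assumed range of `p` (`quadratic_form_nonpos`, `time_derivative_nonpos`).

Where `∇v = 0`, the function `P` is minimal in time, so `∂_t P = 0`, and `Γ(v)` itself has a local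
spatial maximum; then `Γ'(v) Δ_f v ≤ 0` suffices.

All tensor identities are checked at one point, in a chart where the metric is the identity to first
order (`exists_normalAt`). -/

noncomputable section

namespace PME

/-! ### Partial derivatives -/

section PartialDerivatives

variable {n : ℕ} {i j : Fin n} {F G : EuclideanSpace ℝ (Fin n) → ℝ} {y : EuclideanSpace ℝ (Fin n)}

theorem partialD_congr (h : F =ᶠ[nhds y] G) : partialD i F y = partialD i G y := by
  simp only [partialD, h.fderiv_eq]

theorem partialD_eventuallyEq (h : F =ᶠ[nhds y] G) : partialD i F =ᶠ[nhds y] partialD i G := by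
  filter_upwards [h.eventuallyEq_nhds] with z hz using partialD_congr hz

theorem hasDerivAt_line (hF : DifferentiableAt ℝ F y) (w : EuclideanSpace ℝ (Fin n)) {τ : ℝ}
    {y₀ : EuclideanSpace ℝ (Fin n)} (hy : y₀ + τ • w = y) :
    HasDerivAt (fun τ : ℝ => F (y₀ + τ • w)) (fderiv ℝ F y w) τ := by
  subst hy
  have h : HasDerivAt (fun τ : ℝ => y₀ + τ • w) w τ := by
    simpa using ((hasDerivAt_id τ).smul_const w).const_add y₀
  exact hF.hasFDerivAt.comp_hasDerivAt τ h

@[simp] theorem partialD_const (c : ℝ) : partialD i (fun _ => c) y = 0 := by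
  simp [partialD]

theorem partialD_add (hF : DifferentiableAt ℝ F y) (hG : DifferentiableAt ℝ G y) :
    partialD i (fun z => F z + G z) y = partialD i F y + partialD i G y := by
  simp [partialD, fderiv_fun_add hF hG]

theorem partialD_sub (hF : DifferentiableAt ℝ F y) (hG : DifferentiableAt ℝ G y) :
    partialD i (fun z => F z - G z) y = partialD i F y - partialD i G y := by
  simp [partialD, fderiv_fun_sub hF hG]

theorem partialD_mul (hF : DifferentiableAt ℝ F y) (hG : DifferentiableAt ℝ G y) :
    partialD i (fun z => F z * G z) y = partialD i F y * G y + F y * partialD i G y := by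
  simp [partialD, fderiv_fun_mul hF hG]; ring

theorem partialD_const_mul (c : ℝ) (hF : DifferentiableAt ℝ F y) :
    partialD i (fun z => c * F z) y = c * partialD i F y := by
  simp [partialD, fderiv_const_mul hF]

theorem partialD_sum {ι : Type*} {s : Finset ι} {K : ι → EuclideanSpace ℝ (Fin n) → ℝ}
    (hK : ∀ a ∈ s, DifferentiableAt ℝ (K a) y) :
    partialD i (fun z => ∑ a ∈ s, K a z) y = ∑ a ∈ s, partialD i (K a) y := by
  simp [partialD, fderiv_fun_sum hK]

theorem contDiffAt_partialD {r r' : WithTop ℕ∞} (hF : ContDiffAt ℝ r F y) (hr : r' + 1 ≤ r) :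
    ContDiffAt ℝ r' (partialD i F) y :=
  (hF.fderiv_right hr).clm_apply contDiffAt_const

theorem partialD_comm (hF : ContDiffAt ℝ 2 F y) :
    partialD i (partialD j F) y = partialD j (partialD i F) y := by
  have h := hF.isSymmSndFDerivAt (by simp)
  have hd : DifferentiableAt ℝ (fderiv ℝ F) y :=
    (hF.fderiv_right (m := 1) (by norm_num)).differentiableAt (by norm_num)
  change fderiv ℝ (fun z => fderiv ℝ F z (EuclideanSpace.single j 1)) y _
    = fderiv ℝ (fun z => fderiv ℝ F z (EuclideanSpace.single i 1)) y _
  rw [fderiv_clm_apply hd (by fun_prop), fderiv_clm_apply hd (by fun_prop)]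
  simpa using h _ _

end PartialDerivatives

/-! ### Functions of time and space -/

section SpaceTime

variable {n : ℕ} {T : ℝ} {U : Set (EuclideanSpace ℝ (Fin n))}
  {V : ℝ × EuclideanSpace ℝ (Fin n) → ℝ}

theorem uniqueDiffOn_Icc_prod (hT : 0 < T) (hU : IsOpen U) :
    UniqueDiffOn ℝ (Set.Icc 0 T ×ˢ U) :=
  (uniqueDiffOn_Icc hT).prod hU.uniqueDiffOn

/-- Data are regular only on the closed time interval, so joint derivatives are taken within `[0,T]
× U`. A spatial derivative sees no boundary and is that derivative evaluated on a purely spatial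
vector; joint regularity of spatial derivatives follows from this. -/
theorem partialD_eq_fderivWithin (hU : IsOpen U)
    (hV : DifferentiableOn ℝ V (Set.Icc 0 T ×ˢ U)) (i : Fin n)
    {q : ℝ × EuclideanSpace ℝ (Fin n)} (hq : q ∈ Set.Icc 0 T ×ˢ U) :
    partialD i (fun z => V (q.1, z)) q.2
      = fderivWithin ℝ V (Set.Icc 0 T ×ˢ U) q (0, EuclideanSpace.single i 1) := by
  have h1 := (hV q hq).hasFDerivWithinAt
  have h2 : HasFDerivWithinAt (fun z : EuclideanSpace ℝ (Fin n) => (q.1, z))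
      (ContinuousLinearMap.inr ℝ ℝ (EuclideanSpace ℝ (Fin n))) U q.2 :=
    (hasFDerivAt_prodMk_right q.1 q.2).hasFDerivWithinAt
  have h3 := HasFDerivWithinAt.comp (x := q.2) (f := fun z => (q.1, z)) (g := V)
    (t := Set.Icc 0 T ×ˢ U) h1 h2 (fun z hz => ⟨hq.1, hz⟩)
  have h4 := (h3.hasFDerivAt (hU.mem_nhds hq.2)).fderiv
  unfold partialD
  rw [show (fun z => V (q.1, z)) = V ∘ fun z => (q.1, z) from rfl, h4]
  simp

theorem contDiffOn_partialD (hT : 0 < T) (hU : IsOpen U) {r r' : WithTop ℕ∞}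
    (hV : ContDiffOn ℝ r V (Set.Icc 0 T ×ˢ U)) (hr : r' + 1 ≤ r) (i : Fin n) :
    ContDiffOn ℝ r' (fun q : ℝ × EuclideanSpace ℝ (Fin n) =>
      partialD i (fun z => V (q.1, z)) q.2) (Set.Icc 0 T ×ˢ U) := by
  have h0 : r ≠ 0 := by
    rintro rfl
    simp at hr
  have h := (hV.fderivWithin (uniqueDiffOn_Icc_prod hT hU) hr).clm_apply
    (contDiffOn_const (c := ((0, EuclideanSpace.single i 1) : ℝ × EuclideanSpace ℝ (Fin n))))
  exact h.congr fun q hq => partialD_eq_fderivWithin hU (hV.differentiableOn h0) i hq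

theorem contDiffAt_slice {r : WithTop ℕ∞} (hU : IsOpen U)
    (hV : ContDiffOn ℝ r V (Set.Icc 0 T ×ˢ U)) {t : ℝ} (ht : t ∈ Set.Icc 0 T)
    {y : EuclideanSpace ℝ (Fin n)} (hy : y ∈ U) :
    ContDiffAt ℝ r (fun z => V (t, z)) y := by
  have h : ContDiffOn ℝ r (fun z => V (t, z)) U :=
    hV.comp (contDiffOn_const.prodMk contDiffOn_id) fun z hz => ⟨ht, hz⟩
  exact h.contDiffAt (hU.mem_nhds hy)

theorem contDiffAt_interior {r : WithTop ℕ∞} (hU : IsOpen U)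
    (hV : ContDiffOn ℝ r V (Set.Icc 0 T ×ˢ U)) {t : ℝ} (ht : t ∈ Set.Ioo 0 T)
    {y : EuclideanSpace ℝ (Fin n)} (hy : y ∈ U) : ContDiffAt ℝ r V (t, y) :=
  hV.contDiffAt (prod_mem_nhds (Icc_mem_nhds ht.1 ht.2) (hU.mem_nhds hy))

theorem deriv_time_eq {t : ℝ} {y : EuclideanSpace ℝ (Fin n)} (hV : DifferentiableAt ℝ V (t, y)) :
    deriv (fun τ => V (τ, y)) t = fderiv ℝ V (t, y) (1, 0) := by
  have h : HasDerivAt (fun τ : ℝ => (τ, y)) ((1 : ℝ), (0 : EuclideanSpace ℝ (Fin n))) t :=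
    (hasDerivAt_id t).prodMk (hasDerivAt_const t y)
  exact (hV.hasFDerivAt.comp_hasDerivAt t h).deriv

theorem partialD_slice_eq {t : ℝ} {y : EuclideanSpace ℝ (Fin n)} (i : Fin n)
    (hV : DifferentiableAt ℝ V (t, y)) :
    partialD i (fun z => V (t, z)) y = fderiv ℝ V (t, y) (0, EuclideanSpace.single i 1) := by
  have h2 := hasFDerivAt_prodMk_right (𝕜 := ℝ) t y
  have h := (hV.hasFDerivAt.comp y h2).fderiv
  unfold partialD
  rw [show (fun z => V (t, z)) = V ∘ fun z => (t, z) from rfl, h]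
  simp

/-- Time and space derivatives commute. -/
theorem deriv_partialD_comm {t : ℝ} {y : EuclideanSpace ℝ (Fin n)} (i : Fin n)
    (hV : ContDiffAt ℝ 2 V (t, y)) :
    deriv (fun τ => partialD i (fun z => V (τ, z)) y) t
      = partialD i (fun z => deriv (fun τ => V (τ, z)) t) y := by
  have hs := hV.isSymmSndFDerivAt (by simp)
  have hd : DifferentiableAt ℝ (fderiv ℝ V) (t, y) :=
    (hV.fderiv_right (m := 1) (by norm_num)).differentiableAt (by norm_num)
  have hev : ∀ᶠ q in nhds (t, y), DifferentiableAt ℝ V q := by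
    filter_upwards [hV.eventually (by simp)] with q hq using hq.differentiableAt (by norm_num)
  have e1 : (fun τ => partialD i (fun z => V (τ, z)) y) =ᶠ[nhds t]
      fun τ => fderiv ℝ V (τ, y) (0, EuclideanSpace.single i 1) := by
    have hc : Filter.Tendsto (fun τ : ℝ => (τ, y)) (nhds t) (nhds (t, y)) :=
      (by fun_prop : Continuous fun τ : ℝ => (τ, y)).tendsto t
    filter_upwards [hc.eventually hev] with τ hτ using partialD_slice_eq i hτ
  have e2 : (fun z => deriv (fun τ => V (τ, z)) t) =ᶠ[nhds y]
      fun z => fderiv ℝ V (t, z) (1, 0) := by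
    have hc : Filter.Tendsto (fun z : EuclideanSpace ℝ (Fin n) => (t, z)) (nhds y)
        (nhds (t, y)) :=
      (by fun_prop : Continuous fun z : EuclideanSpace ℝ (Fin n) => (t, z)).tendsto y
    filter_upwards [hc.eventually hev] with z hz using deriv_time_eq hz
  rw [e1.deriv_eq, partialD_congr e2,
    deriv_time_eq (V := fun q => fderiv ℝ V q (0, EuclideanSpace.single i 1))
      (hd.clm_apply (by fun_prop)),
    partialD_slice_eq (V := fun q => fderiv ℝ V q (1, 0)) i (hd.clm_apply (by fun_prop)),
    fderiv_clm_apply hd (by fun_prop), fderiv_clm_apply hd (by fun_prop)]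
  simpa using hs _ _

end SpaceTime

/-! ### Second derivative test -/

/-- If the second derivative were positive, the point would be a local minimum as well as a local
maximum. The function would then be locally constant, with vanishing second derivative. -/
theorem second_deriv_nonpos_of_isLocalMax {h h' : ℝ → ℝ} {c x : ℝ}
    (hh : ∀ᶠ τ in nhds x, HasDerivAt h (h' τ) τ) (hc : HasDerivAt h' c x) (hm : IsLocalMax h x) :
    c ≤ 0 := by
  by_contra hpos
  push Not at hpos
  have e : deriv h =ᶠ[nhds x] h' := by filter_upwards [hh] with τ hτ using hτ.deriv
  have h1 : deriv h x = 0 := hm.deriv_eq_zero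
  have h2 : deriv (deriv h) x = c := by rw [e.deriv_eq, hc.deriv]
  have hmin : IsLocalMin h x :=
    isLocalMin_of_deriv_deriv_pos (by rw [h2]; exact hpos) h1 hh.self_of_nhds.continuousAt
  have hcst : h =ᶠ[nhds x] fun _ => h x := by
    filter_upwards [hm, hmin] with τ h3 h4 using le_antisymm h3 h4
  have : deriv h =ᶠ[nhds x] fun _ => 0 := by
    filter_upwards [hcst.eventuallyEq_nhds] with τ hτ
    rw [hτ.deriv_eq]; simp
  rw [this.deriv_eq] at h2
  simp at h2
  linarith

/-! ### Inverse matrices depending on parameters -/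

section MatrixInverse

variable {n : ℕ} {X : Type*} [NormedAddCommGroup X] [NormedSpace ℝ X]

theorem contDiffWithinAt_det {A : X → Matrix (Fin n) (Fin n) ℝ} {S : Set X} {x : X}
    {r : WithTop ℕ∞} (hA : ∀ i j, ContDiffWithinAt ℝ r (fun z => A z i j) S x) :
    ContDiffWithinAt ℝ r (fun z => (A z).det) S x := by
  simp only [Matrix.det_apply]
  refine ContDiffWithinAt.sum fun σ _ => ?_
  refine ContDiffWithinAt.const_smul _ ?_
  exact contDiffWithinAt_prod fun i _ => hA _ _

/-- By Cramer's rule the entries of the inverse are rational functions of the entries of the matrix.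
-/
theorem contDiffWithinAt_matrix_inv {A : X → Matrix (Fin n) (Fin n) ℝ} {S : Set X} {x : X}
    {r : WithTop ℕ∞} (hA : ∀ i j, ContDiffWithinAt ℝ r (fun z => A z i j) S x)
    (hdet : (A x).det ≠ 0) (i j : Fin n) :
    ContDiffWithinAt ℝ r (fun z => (A z)⁻¹ i j) S x := by
  simp only [Matrix.inv_def, Matrix.smul_apply, Ring.inverse_eq_inv', smul_eq_mul,
    Matrix.adjugate_apply]
  refine ((contDiffWithinAt_det hA).inv hdet).mul (contDiffWithinAt_det fun a b => ?_)
  simp only [Matrix.updateRow_apply]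
  split_ifs
  · exact contDiffWithinAt_const
  · exact hA a b

theorem contDiffAt_matrix_inv {A : X → Matrix (Fin n) (Fin n) ℝ} {x : X}
    {r : WithTop ℕ∞} (hA : ∀ i j, ContDiffAt ℝ r (fun z => A z i j) x)
    (hdet : (A x).det ≠ 0) (i j : Fin n) : ContDiffAt ℝ r (fun z => (A z)⁻¹ i j) x :=
  contDiffWithinAt_univ.1 <| contDiffWithinAt_matrix_inv
    (fun i j => contDiffWithinAt_univ.2 (hA i j)) hdet i j

theorem eventually_sum_mul_inv {X : Type*} [TopologicalSpace X] {A : X → Matrix (Fin n) (Fin n) ℝ} {x : X}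
    (hA : ∀ i j, ContinuousAt (fun z => A z i j) x)
    (hdet : (A x).det ≠ 0) (i k : Fin n) :
    ∀ᶠ z in nhds x, ∑ j, A z i j * (A z)⁻¹ j k = if i = k then 1 else 0 := by
  have hA' : ContinuousAt A x := by
    refine continuousAt_pi.2 fun i => continuousAt_pi.2 fun j => hA i j
  have hc : ContinuousAt (fun z => (A z).det) x :=
    ContinuousAt.comp (f := A) (g := Matrix.det) (continuous_id.matrix_det).continuousAt hA'
  filter_upwards [hc.eventually_ne hdet] with z hz
  have := congrFun (congrFun (Matrix.mul_nonsing_inv (A z) (isUnit_iff_ne_zero.2 hz)) i) k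
  simpa [Matrix.mul_apply, Matrix.one_apply] using this

/-- The derivative of the inverse matrix at a point where the matrix is the identity. -/
theorem hasDerivAt_matrix_inv {A : ℝ → Matrix (Fin n) (Fin n) ℝ} {t : ℝ}
    (hA : ∀ i j, ContDiffAt ℝ 1 (fun τ => A τ i j) t) (h1 : A t = 1) (i k : Fin n) :
    HasDerivAt (fun τ => (A τ)⁻¹ i k) (-deriv (fun τ => A τ i k) t) t := by
  have hdet : (A t).det ≠ 0 := by simp [h1]
  have hA' : ∀ i j, HasDerivAt (fun τ => A τ i j) (deriv (fun τ => A τ i j) t) t := fun i j =>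
    ((hA i j).differentiableAt (by norm_num)).hasDerivAt
  have hB' : ∀ i j, HasDerivAt (fun τ => (A τ)⁻¹ i j) (deriv (fun τ => (A τ)⁻¹ i j) t) t :=
    fun i j => ((contDiffAt_matrix_inv hA hdet i j).differentiableAt (by norm_num)).hasDerivAt
  -- Differentiating `A A⁻¹ = 1` at a time when `A = 1` gives `A' + (A⁻¹)' = 0`.
  have e : (fun τ => ∑ j, A τ i j * (A τ)⁻¹ j k) =ᶠ[nhds t] fun _ => if i = k then 1 else 0 :=
    eventually_sum_mul_inv (fun i j => (hA i j).continuousAt) hdet i k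
  have h := (HasDerivAt.fun_sum (u := Finset.univ) fun j _ => (hA' i j).mul (hB' j k)).deriv
  have h' : deriv (fun τ => ∑ j, A τ i j * (A τ)⁻¹ j k) t = 0 := by rw [e.deriv_eq]; simp
  change deriv (fun τ => ∑ j, A τ i j * (A τ)⁻¹ j k) t = _ at h
  rw [h'] at h
  simp only [h1, inv_one, Matrix.one_apply, mul_ite, mul_one, mul_zero, ite_mul, one_mul,
    zero_mul, Finset.sum_add_distrib, Finset.sum_ite_eq, Finset.sum_ite_eq', Finset.mem_univ,
    if_true] at h
  have := hB' i k
  rwa [show deriv (fun τ => (A τ)⁻¹ i k) t = -deriv (fun τ => A τ i k) t by linarith] at this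

end MatrixInverse

/-! ### Normal coordinates -/

section Normal

variable {n : ℕ} {M : Type*} [TopologicalSpace M] [ChartedSpace (EuclideanSpace ℝ (Fin n)) M]

/-- The components of the metric are the identity matrix at the point with coordinates `y`, and
their first derivatives vanish there. -/
structure NormalAt (g : Metric n M) (φ : OpenPartialHomeomorph M (EuclideanSpace ℝ (Fin n)))
    (y : EuclideanSpace ℝ (Fin n)) : Prop where
  contDiffAt : ∀ i j, ContDiffAt ℝ 2 (metricComp g φ i j) y
  comp_eq : ∀ i j, metricComp g φ i j y = if i = j then 1 else 0
  partialD_eq : ∀ l i j, partialD l (metricComp g φ i j) y = 0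

variable {g : Metric n M} {φ : OpenPartialHomeomorph M (EuclideanSpace ℝ (Fin n))}
  {y : EuclideanSpace ℝ (Fin n)}

theorem metricComp_symm (i j : Fin n) : metricComp g φ i j = metricComp g φ j i := by
  funext z
  exact g.symm _ _ _

theorem differentiableAt_partialD {F : EuclideanSpace ℝ (Fin n) → ℝ} (hF : ContDiffAt ℝ 2 F y)
    (i : Fin n) : DifferentiableAt ℝ (partialD i F) y :=
  (contDiffAt_partialD (r' := 1) hF (by norm_num)).differentiableAt (by norm_num)

/-! ### Derivatives of the inverse metric and of the Christoffel symbols at the centre -/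

namespace NormalAt

theorem matrix_eq (h : NormalAt g φ y) : (Matrix.of fun a b => metricComp g φ a b y) = 1 := by
  ext i j
  simp [h.comp_eq, Matrix.one_apply]

theorem det_ne_zero (h : NormalAt g φ y) :
    (Matrix.of fun a b => metricComp g φ a b y).det ≠ 0 := by
  simp [h.matrix_eq]

theorem metricInv_eq (h : NormalAt g φ y) (i j : Fin n) :
    metricInv g φ i j y = if i = j then 1 else 0 := by
  rw [metricInv, h.matrix_eq, inv_one, Matrix.one_apply]

theorem contDiffAt_inv (h : NormalAt g φ y) (i j : Fin n) :
    ContDiffAt ℝ 2 (metricInv g φ i j) y :=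
  contDiffAt_matrix_inv (A := fun z => Matrix.of fun a b => metricComp g φ a b z)
    h.contDiffAt h.det_ne_zero i j

theorem differentiableAt (h : NormalAt g φ y) (i j : Fin n) :
    DifferentiableAt ℝ (metricComp g φ i j) y :=
  (h.contDiffAt i j).differentiableAt (by norm_num)

theorem differentiableAt_inv (h : NormalAt g φ y) (i j : Fin n) :
    DifferentiableAt ℝ (metricInv g φ i j) y :=
  (h.contDiffAt_inv i j).differentiableAt (by norm_num)

/-- The derivative of `g g⁻¹ = 1`. It is needed on a neighbourhood, not only at the centre, because
it is differentiated once more to obtain the second derivatives of `g⁻¹`. -/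
theorem eventually_partialD_sum (h : NormalAt g φ y) (l i k : Fin n) :
    (fun z => ∑ j, (partialD l (metricComp g φ i j) z * metricInv g φ j k z
      + metricComp g φ i j z * partialD l (metricInv g φ j k) z)) =ᶠ[nhds y] fun _ => 0 := by
  have e : (fun z => ∑ j, metricComp g φ i j z * metricInv g φ j k z) =ᶠ[nhds y]
      fun _ => if i = k then 1 else 0 :=
    eventually_sum_mul_inv (A := fun z => Matrix.of fun a b => metricComp g φ a b z)
      (fun i j => (h.contDiffAt i j).continuousAt) h.det_ne_zero i k
  have hc : ∀ᶠ z in nhds y, ∀ j, DifferentiableAt ℝ (metricComp g φ i j) z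
      ∧ DifferentiableAt ℝ (metricInv g φ j k) z := by
    rw [Filter.eventually_all]
    intro j
    filter_upwards [(h.contDiffAt i j).eventually (by simp),
      (h.contDiffAt_inv j k).eventually (by simp)] with z h1 h2
    exact ⟨h1.differentiableAt (by norm_num), h2.differentiableAt (by norm_num)⟩
  filter_upwards [partialD_eventuallyEq (i := l) e, hc] with z h1 h2
  rw [partialD_sum (fun j _ => (h2 j).1.fun_mul (h2 j).2), partialD_const] at h1
  rw [← h1]
  exact Finset.sum_congr rfl fun j _ => (partialD_mul (h2 j).1 (h2 j).2).symm

theorem partialD_inv (h : NormalAt g φ y) (l i k : Fin n) :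
    partialD l (metricInv g φ i k) y = 0 := by
  have := (h.eventually_partialD_sum l i k).self_of_nhds
  simpa [h.partialD_eq, h.comp_eq] using this

theorem partialD_partialD_inv (h : NormalAt g φ y) (l i k : Fin n) :
    partialD l (partialD l (metricInv g φ i k)) y
      = -partialD l (partialD l (metricComp g φ i k)) y := by
  have e := partialD_congr (i := l) (h.eventually_partialD_sum l i k)
  have d1 : ∀ i j, DifferentiableAt ℝ (partialD l (metricComp g φ i j)) y := fun i j =>
    differentiableAt_partialD (h.contDiffAt i j) l
  have d2 : ∀ i j, DifferentiableAt ℝ (partialD l (metricInv g φ i j)) y := fun i j =>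
    differentiableAt_partialD (h.contDiffAt_inv i j) l
  rw [partialD_const, partialD_sum (fun j _ => ((d1 i j).fun_mul (h.differentiableAt_inv j k)).fun_add
    ((h.differentiableAt i j).fun_mul (d2 j k)))] at e
  have e2 : ∀ j, partialD l (fun z => partialD l (metricComp g φ i j) z * metricInv g φ j k z
      + metricComp g φ i j z * partialD l (metricInv g φ j k) z) y
      = partialD l (partialD l (metricComp g φ i j)) y * (if j = k then 1 else 0)
        + (if i = j then 1 else 0) * partialD l (partialD l (metricInv g φ j k)) y := by
    intro j
    rw [partialD_add ((d1 i j).fun_mul (h.differentiableAt_inv j k))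
      ((h.differentiableAt i j).fun_mul (d2 j k)), partialD_mul (d1 i j) (h.differentiableAt_inv j k),
      partialD_mul (h.differentiableAt i j) (d2 j k), h.partialD_eq, h.comp_eq, h.metricInv_eq]
    ring
  simp only [e2, Finset.sum_add_distrib, mul_ite, mul_one, mul_zero, ite_mul, one_mul, zero_mul,
    Finset.sum_ite_eq, Finset.sum_ite_eq', Finset.mem_univ, if_true] at e
  linarith

theorem christoffel_eq (h : NormalAt g φ y) (k i j : Fin n) : christoffel g φ k i j y = 0 := by
  simp [christoffel, h.partialD_eq]

theorem differentiableAt_christoffel (h : NormalAt g φ y) (k i j : Fin n) :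
    DifferentiableAt ℝ (christoffel g φ k i j) y := by
  unfold christoffel
  refine DifferentiableAt.fun_sum fun l _ => DifferentiableAt.fun_mul ?_ ?_
  · have := h.differentiableAt_inv k l
    fun_prop
  exact ((differentiableAt_partialD (h.contDiffAt j l) i).fun_add
    (differentiableAt_partialD (h.contDiffAt i l) j)).fun_sub
    (differentiableAt_partialD (h.contDiffAt i j) l)

/-- Only the derivative of the bracket survives: the bracket itself vanishes at the centre, so the
derivative of `g⁻¹` does not contribute. -/
theorem partialD_christoffel (h : NormalAt g φ y) (l k i j : Fin n) :
    partialD l (christoffel g φ k i j) y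
      = (partialD l (partialD i (metricComp g φ j k)) y
        + partialD l (partialD j (metricComp g φ i k)) y
        - partialD l (partialD k (metricComp g φ i j)) y) / 2 := by
  have d1 : ∀ l i j, DifferentiableAt ℝ (partialD l (metricComp g φ i j)) y := fun l i j =>
    differentiableAt_partialD (h.contDiffAt i j) l
  have d2 : ∀ a, DifferentiableAt ℝ (fun z => metricInv g φ k a z / 2) y := fun a => by
    have := h.differentiableAt_inv k a
    fun_prop
  have d3 : ∀ a, DifferentiableAt ℝ (fun z => partialD i (metricComp g φ j a) z
      + partialD j (metricComp g φ i a) z - partialD a (metricComp g φ i j) z) y := fun a =>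
    ((d1 i j a).fun_add (d1 j i a)).fun_sub (d1 a i j)
  change partialD l (fun z => ∑ a, metricInv g φ k a z / 2 * (partialD i (metricComp g φ j a) z
      + partialD j (metricComp g φ i a) z - partialD a (metricComp g φ i j) z)) y = _
  rw [partialD_sum (fun a _ => (d2 a).fun_mul (d3 a))]
  have e : ∀ a, partialD l (fun z => metricInv g φ k a z / 2 * (partialD i (metricComp g φ j a) z
      + partialD j (metricComp g φ i a) z - partialD a (metricComp g φ i j) z)) y
      = if k = a then (partialD l (partialD i (metricComp g φ j a)) y
        + partialD l (partialD j (metricComp g φ i a)) y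
        - partialD l (partialD a (metricComp g φ i j)) y) / 2 else 0 := by
    intro a
    rw [partialD_mul (d2 a) (d3 a), partialD_sub ((d1 i j a).fun_add (d1 j i a)) (d1 a i j),
      partialD_add (d1 i j a) (d1 j i a), h.partialD_eq, h.partialD_eq, h.partialD_eq,
      h.metricInv_eq]
    split_ifs <;> ring
  simp only [e, Finset.sum_ite_eq, Finset.mem_univ, if_true]

end NormalAt

/-! ### The Bochner formula at the centre of normal coordinates -/

/-- `⟨∇W, ∇Z⟩` in coordinates. -/
def coordGradInner (g : Metric n M) (φ : OpenPartialHomeomorph M (EuclideanSpace ℝ (Fin n)))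
    (W Z : EuclideanSpace ℝ (Fin n) → ℝ) (y : EuclideanSpace ℝ (Fin n)) : ℝ :=
  ∑ i, ∑ j, metricInv g φ i j y * partialD i W y * partialD j Z y

/-- `Δ_f w` as a function on coordinate space. -/
def coordFLaplacian (g : Metric n M) (φ : OpenPartialHomeomorph M (EuclideanSpace ℝ (Fin n)))
    (f w : M → ℝ) (y : EuclideanSpace ℝ (Fin n)) : ℝ :=
  ∑ i, ∑ j, metricInv g φ i j y * hessian g φ w i j y
    - coordGradInner g φ (f ∘ φ.symm) (w ∘ φ.symm) y

namespace NormalAt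

variable {W Z : EuclideanSpace ℝ (Fin n) → ℝ} {f w : M → ℝ}

theorem differentiableAt_gradInner_term (h : NormalAt g φ y) (hW : ContDiffAt ℝ 2 W y)
    (hZ : ContDiffAt ℝ 2 Z y) (i j : Fin n) : DifferentiableAt ℝ
      (fun z => metricInv g φ i j z * partialD i W z * partialD j Z z) y :=
  ((h.differentiableAt_inv i j).fun_mul (differentiableAt_partialD hW i)).fun_mul
    (differentiableAt_partialD hZ j)

theorem differentiableAt_coordGradInner (h : NormalAt g φ y) (hW : ContDiffAt ℝ 2 W y)
    (hZ : ContDiffAt ℝ 2 Z y) : DifferentiableAt ℝ (coordGradInner g φ W Z) y := by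
  unfold coordGradInner
  exact DifferentiableAt.fun_sum fun i _ => DifferentiableAt.fun_sum fun j _ =>
    h.differentiableAt_gradInner_term hW hZ i j

theorem coordGradInner_eq (h : NormalAt g φ y) :
    coordGradInner g φ W Z y = ∑ i, partialD i W y * partialD i Z y := by
  simp [coordGradInner, h.metricInv_eq]

theorem partialD_coordGradInner (h : NormalAt g φ y) (hW : ContDiffAt ℝ 2 W y)
    (hZ : ContDiffAt ℝ 2 Z y) (l : Fin n) :
    partialD l (coordGradInner g φ W Z) y
      = ∑ i, (partialD l (partialD i W) y * partialD i Z y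
        + partialD i W y * partialD l (partialD i Z) y) := by
  change partialD l (fun z => ∑ i, ∑ j, metricInv g φ i j z * partialD i W z * partialD j Z z) y
    = _
  rw [partialD_sum fun i _ => DifferentiableAt.fun_sum fun j _ =>
    h.differentiableAt_gradInner_term hW hZ i j]
  refine Finset.sum_congr rfl fun i _ => ?_
  rw [partialD_sum fun j _ => h.differentiableAt_gradInner_term hW hZ i j]
  have e : ∀ j, partialD l (fun z => metricInv g φ i j z * partialD i W z * partialD j Z z) y
      = if i = j then partialD l (partialD i W) y * partialD j Z y
        + partialD i W y * partialD l (partialD j Z) y else 0 := by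
    intro j
    rw [partialD_mul ((h.differentiableAt_inv i j).fun_mul (differentiableAt_partialD hW i))
      (differentiableAt_partialD hZ j), partialD_mul (h.differentiableAt_inv i j)
      (differentiableAt_partialD hW i), h.partialD_inv, h.metricInv_eq]
    split_ifs <;> ring
  simp only [e, Finset.sum_ite_eq, Finset.mem_univ, if_true]

/-- The first derivatives of `g⁻¹` vanish at the centre, so the metric enters only through `∂_l∂_l
g^ij = -∂_l∂_l g_ij`. This term supplies one half of the curvature in the Bochner formula. -/
theorem partialD_partialD_coordGradInner_self (h : NormalAt g φ y) (hW : ContDiffAt ℝ 3 W y)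
    (l : Fin n) :
    partialD l (partialD l (coordGradInner g φ W W)) y
      = ∑ i, ∑ j, -(partialD l (partialD l (metricComp g φ i j)) y
          * partialD i W y * partialD j W y)
        + ∑ i, (2 * (partialD l (partialD l (partialD i W)) y * partialD i W y)
          + 2 * partialD l (partialD i W) y ^ 2) := by
  have hW2 : ContDiffAt ℝ 2 W y := hW.of_le (by norm_num)
  have hWi : ∀ i, ContDiffAt ℝ 2 (partialD i W) y := fun i =>
    contDiffAt_partialD hW (by norm_num)
  have ev : ∀ᶠ z in nhds y, ∀ i j, DifferentiableAt ℝ (metricInv g φ i j) z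
      ∧ DifferentiableAt ℝ (partialD i W) z ∧ DifferentiableAt ℝ (partialD j W) z := by
    simp only [Filter.eventually_all]
    intro i j
    filter_upwards [(h.contDiffAt_inv i j).eventually (by simp), (hWi i).eventually (by simp),
      (hWi j).eventually (by simp)] with z h1 h2 h3
    exact ⟨h1.differentiableAt (by norm_num), h2.differentiableAt (by norm_num),
      h3.differentiableAt (by norm_num)⟩
  have e : partialD l (coordGradInner g φ W W) =ᶠ[nhds y] fun z => ∑ i, ∑ j,
      ((partialD l (metricInv g φ i j) z * partialD i W z
        + metricInv g φ i j z * partialD l (partialD i W) z) * partialD j W z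
        + metricInv g φ i j z * partialD i W z * partialD l (partialD j W) z) := by
    filter_upwards [ev] with z hz
    change partialD l (fun z => ∑ i, ∑ j, metricInv g φ i j z * partialD i W z * partialD j W z) z
      = _
    rw [partialD_sum fun i _ => DifferentiableAt.fun_sum fun j _ =>
      ((hz i j).1.fun_mul (hz i j).2.1).fun_mul (hz i j).2.2]
    refine Finset.sum_congr rfl fun i _ => ?_
    rw [partialD_sum fun j _ => ((hz i j).1.fun_mul (hz i j).2.1).fun_mul (hz i j).2.2]
    refine Finset.sum_congr rfl fun j _ => ?_
    rw [partialD_mul ((hz i j).1.fun_mul (hz i j).2.1) (hz i j).2.2,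
      partialD_mul (hz i j).1 (hz i j).2.1]
  have dB := fun i j => h.differentiableAt_inv i j
  have dB' : ∀ i j, DifferentiableAt ℝ (partialD l (metricInv g φ i j)) y := fun i j =>
    differentiableAt_partialD (h.contDiffAt_inv i j) l
  have dW : ∀ i, DifferentiableAt ℝ (partialD i W) y := fun i => differentiableAt_partialD hW2 i
  have dW' : ∀ i, DifferentiableAt ℝ (partialD l (partialD i W)) y := fun i =>
    differentiableAt_partialD (hWi i) l
  have d1 : ∀ i j, DifferentiableAt ℝ (fun z => partialD l (metricInv g φ i j) z * partialD i W z
      + metricInv g φ i j z * partialD l (partialD i W) z) y := fun i j =>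
    ((dB' i j).fun_mul (dW i)).fun_add ((dB i j).fun_mul (dW' i))
  have d2 : ∀ i j, DifferentiableAt ℝ (fun z => (partialD l (metricInv g φ i j) z * partialD i W z
      + metricInv g φ i j z * partialD l (partialD i W) z) * partialD j W z) y := fun i j =>
    (d1 i j).fun_mul (dW j)
  have d3 : ∀ i j, DifferentiableAt ℝ (fun z => metricInv g φ i j z * partialD i W z
      * partialD l (partialD j W) z) y := fun i j => ((dB i j).fun_mul (dW i)).fun_mul (dW' j)
  rw [partialD_congr e, partialD_sum fun i _ => DifferentiableAt.fun_sum fun j _ =>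
    (d2 i j).fun_add (d3 i j), ← Finset.sum_add_distrib]
  refine Finset.sum_congr rfl fun i _ => ?_
  rw [partialD_sum fun j _ => (d2 i j).fun_add (d3 i j)]
  have e2 : ∀ j, partialD l (fun z => (partialD l (metricInv g φ i j) z * partialD i W z
        + metricInv g φ i j z * partialD l (partialD i W) z) * partialD j W z
        + metricInv g φ i j z * partialD i W z * partialD l (partialD j W) z) y
      = -(partialD l (partialD l (metricComp g φ i j)) y * partialD i W y * partialD j W y)
        + if i = j then 2 * (partialD l (partialD l (partialD j W)) y * partialD j W y)
          + 2 * partialD l (partialD j W) y ^ 2 else 0 := by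
    intro j
    rw [partialD_add (d2 i j) (d3 i j), partialD_mul (d1 i j) (dW j),
      partialD_add ((dB' i j).fun_mul (dW i)) ((dB i j).fun_mul (dW' i)), partialD_mul (dB' i j) (dW i),
      partialD_mul (dB i j) (dW' i), partialD_mul ((dB i j).fun_mul (dW i)) (dW' j),
      partialD_mul (dB i j) (dW i), h.partialD_partialD_inv, h.partialD_inv, h.metricInv_eq]
    split_ifs with hij
    · subst hij; ring
    · ring
  simp only [e2, Finset.sum_add_distrib, Finset.sum_ite_eq, Finset.mem_univ, if_true]

theorem differentiableAt_hessian (h : NormalAt g φ y) (hw : ContDiffAt ℝ 3 (w ∘ φ.symm) y)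
    (i j : Fin n) : DifferentiableAt ℝ (hessian g φ w i j) y :=
  (differentiableAt_partialD (contDiffAt_partialD hw (by norm_num)) i).fun_sub
    (DifferentiableAt.fun_sum fun k _ => (h.differentiableAt_christoffel k i j).fun_mul
      (differentiableAt_partialD (hw.of_le (by norm_num)) k))

theorem differentiableAt_coordFLaplacian (h : NormalAt g φ y)
    (hw : ContDiffAt ℝ 3 (w ∘ φ.symm) y) (hf : ContDiffAt ℝ 2 (f ∘ φ.symm) y) :
    DifferentiableAt ℝ (coordFLaplacian g φ f w) y :=
  (DifferentiableAt.fun_sum fun i _ => DifferentiableAt.fun_sum fun j _ =>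
    (h.differentiableAt_inv i j).fun_mul (h.differentiableAt_hessian hw i j)).fun_sub
    (h.differentiableAt_coordGradInner hf (hw.of_le (by norm_num)))

theorem coordFLaplacian_eq (h : NormalAt g φ y) :
    coordFLaplacian g φ f w y = ∑ i, partialD i (partialD i (w ∘ φ.symm)) y
      - ∑ i, partialD i (f ∘ φ.symm) y * partialD i (w ∘ φ.symm) y := by
  simp [coordFLaplacian, h.coordGradInner_eq, h.metricInv_eq, hessian, h.christoffel_eq]

theorem partialD_coordFLaplacian (h : NormalAt g φ y) (hw : ContDiffAt ℝ 3 (w ∘ φ.symm) y)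
    (hf : ContDiffAt ℝ 2 (f ∘ φ.symm) y) (l : Fin n) :
    partialD l (coordFLaplacian g φ f w) y
      = ∑ i, (partialD l (partialD i (partialD i (w ∘ φ.symm))) y
          - ∑ k, partialD l (christoffel g φ k i i) y * partialD k (w ∘ φ.symm) y)
        - ∑ i, (partialD l (partialD i (f ∘ φ.symm)) y * partialD i (w ∘ φ.symm) y
          + partialD i (f ∘ φ.symm) y * partialD l (partialD i (w ∘ φ.symm)) y) := by
  have hW2 : ContDiffAt ℝ 2 (w ∘ φ.symm) y := hw.of_le (by norm_num)
  have hWi : ∀ i, ContDiffAt ℝ 2 (partialD i (w ∘ φ.symm)) y := fun i =>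
    contDiffAt_partialD hw (by norm_num)
  have dB := fun i j => h.differentiableAt_inv i j
  have dW : ∀ i, DifferentiableAt ℝ (partialD i (w ∘ φ.symm)) y := fun i =>
    differentiableAt_partialD hW2 i
  have dW' : ∀ i j, DifferentiableAt ℝ (partialD i (partialD j (w ∘ φ.symm))) y := fun i j =>
    differentiableAt_partialD (hWi j) i
  have dC := fun k i j => h.differentiableAt_christoffel k i j
  have dS : ∀ i j, DifferentiableAt ℝ
      (fun z => ∑ k, christoffel g φ k i j z * partialD k (w ∘ φ.symm) z) y := fun i j =>
    DifferentiableAt.fun_sum fun k _ => (dC k i j).fun_mul (dW k)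
  have dH : ∀ i j, DifferentiableAt ℝ (hessian g φ w i j) y := fun i j =>
    (dW' i j).fun_sub (dS i j)
  have hH : ∀ i j, partialD l (hessian g φ w i j) y
      = partialD l (partialD i (partialD j (w ∘ φ.symm))) y
        - ∑ k, partialD l (christoffel g φ k i j) y * partialD k (w ∘ φ.symm) y := by
    intro i j
    change partialD l (fun z => partialD i (partialD j (w ∘ φ.symm)) z
      - ∑ k, christoffel g φ k i j z * partialD k (w ∘ φ.symm) z) y = _
    rw [partialD_sub (dW' i j) (dS i j), partialD_sum fun k _ => (dC k i j).fun_mul (dW k)]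
    congr 1
    refine Finset.sum_congr rfl fun k _ => ?_
    rw [partialD_mul (dC k i j) (dW k), h.christoffel_eq]
    ring
  have dT : ∀ i j, DifferentiableAt ℝ (fun z => metricInv g φ i j z * hessian g φ w i j z) y :=
    fun i j => (dB i j).fun_mul (dH i j)
  change partialD l (fun z => ∑ i, ∑ j, metricInv g φ i j z * hessian g φ w i j z
    - coordGradInner g φ (f ∘ φ.symm) (w ∘ φ.symm) z) y = _
  rw [partialD_sub (DifferentiableAt.fun_sum fun i _ => DifferentiableAt.fun_sum fun j _ => dT i j)
    (h.differentiableAt_coordGradInner hf hW2), h.partialD_coordGradInner hf hW2,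
    partialD_sum fun i _ => DifferentiableAt.fun_sum fun j _ => dT i j]
  congr 1
  refine Finset.sum_congr rfl fun i _ => ?_
  rw [partialD_sum fun j _ => dT i j]
  have e : ∀ j, partialD l (fun z => metricInv g φ i j z * hessian g φ w i j z) y
      = if i = j then partialD l (hessian g φ w i j) y else 0 := by
    intro j
    rw [partialD_mul (dB i j) (dH i j), h.partialD_inv, h.metricInv_eq]
    split_ifs <;> ring
  simp only [e, Finset.sum_ite_eq, Finset.mem_univ, if_true, hH]

/-- Ricci is split according to where its parts arise in the Bochner formula: the derivatives of
`Γ^k_ii` come from differentiating the Laplacian, the terms `∂_l∂_l g_ij` from the Laplacian of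
`|∇w|²`. At the centre everything is linear in the second derivatives of `g`, and only their
symmetry in each pair of indices and a relabelling of the sums are used. -/
theorem ricci_quadratic (h : NormalAt g φ y) (ξ : Fin n → ℝ) :
    ∑ i, ∑ j, ricci g φ i j y * ξ i * ξ j
      = ∑ i, ∑ l, ∑ k, partialD l (christoffel g φ k i i) y * ξ k * ξ l
        - 1 / 2 * ∑ l, ∑ i, ∑ j, partialD l (partialD l (metricComp g φ i j)) y * ξ i * ξ j := by
  set D : Fin n → Fin n → Fin n → Fin n → ℝ := fun a b i j =>
    partialD a (partialD b (metricComp g φ i j)) y with hD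
  have s1 : ∀ a b i j, D a b i j = D b a i j := fun a b i j => partialD_comm (h.contDiffAt i j)
  have s2 : ∀ a b i j, D a b i j = D a b j i := fun a b i j => by
    simp only [hD, metricComp_symm i j]
  have hC : ∀ l k i j, partialD l (christoffel g φ k i j) y
      = (D l i j k + D l j i k - D l k i j) / 2 := fun l k i j => h.partialD_christoffel l k i j
  have hR : ∀ i j, ricci g φ i j y * ξ i * ξ j
      = ∑ k, ((D k i j k + D k j i k) / 2 * ξ i * ξ j
        - D i j k k / 2 * ξ i * ξ j - D k k i j / 2 * ξ i * ξ j) := by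
    intro i j
    simp only [ricci, h.christoffel_eq, hC, mul_zero, sub_zero, Finset.sum_const_zero, add_zero]
    rw [← Finset.sum_sub_distrib, Finset.sum_mul, Finset.sum_mul]
    refine Finset.sum_congr rfl fun k _ => ?_
    rw [s2 i k j k]
    ring
  have rot : ∀ K : Fin n → Fin n → Fin n → ℝ,
      ∑ i, ∑ j, ∑ k, K k i j = ∑ i, ∑ j, ∑ k, K i j k := by
    intro K
    rw [show (∑ i, ∑ j, ∑ k, K k i j) = ∑ i, ∑ k, ∑ j, K k i j from
      Finset.sum_congr rfl fun _ _ => Finset.sum_comm]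
    exact Finset.sum_comm
  have e1 : ∑ i, ∑ j, ∑ k, D k j i k / 2 * ξ i * ξ j = ∑ i, ∑ j, ∑ k, D k i j k / 2 * ξ i * ξ j := by
    rw [Finset.sum_comm]
    refine Finset.sum_congr rfl fun i _ => Finset.sum_congr rfl fun j _ =>
      Finset.sum_congr rfl fun k _ => by ring
  have e2 := rot fun k i j => D k i j k * ξ i * ξ j - D i j k k / 2 * ξ i * ξ j
    - D k k i j / 2 * ξ i * ξ j
  have e3 : ∑ i, ∑ j, ricci g φ i j y * ξ i * ξ j
      = ∑ i, ∑ j, ∑ k, (D k i j k * ξ i * ξ j - D i j k k / 2 * ξ i * ξ j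
        - D k k i j / 2 * ξ i * ξ j) := by
    have e4 : ∀ i j k, D k i j k * ξ i * ξ j
        = D k i j k / 2 * ξ i * ξ j + D k i j k / 2 * ξ i * ξ j := by intros; ring
    simp only [hR, add_div, add_mul, e4, Finset.sum_add_distrib, Finset.sum_sub_distrib, e1]
  rw [e3, e2, Finset.mul_sum, ← Finset.sum_sub_distrib]
  refine Finset.sum_congr rfl fun i _ => ?_
  rw [Finset.mul_sum, ← Finset.sum_sub_distrib]
  refine Finset.sum_congr rfl fun j _ => ?_
  rw [Finset.mul_sum, ← Finset.sum_sub_distrib]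
  refine Finset.sum_congr rfl fun k _ => ?_
  change _ = partialD j (christoffel g φ k i i) y * ξ k * ξ j - 1 / 2 * (D i i j k * ξ j * ξ k)
  rw [hC, s1 i j, s2 j i k i]
  ring

/-- The Bochner formula for `Δ_f`, at the centre of normal coordinates. -/
theorem bochner (h : NormalAt g φ y) (hw : ContDiffAt ℝ 3 (w ∘ φ.symm) y)
    (hf : ContDiffAt ℝ 2 (f ∘ φ.symm) y) :
    ∑ l, partialD l (w ∘ φ.symm) y * partialD l (coordFLaplacian g φ f w) y
      = 1 / 2 * ∑ l, partialD l (partialD l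
          (coordGradInner g φ (w ∘ φ.symm) (w ∘ φ.symm))) y
        - 1 / 2 * ∑ l, partialD l (f ∘ φ.symm) y
          * partialD l (coordGradInner g φ (w ∘ φ.symm) (w ∘ φ.symm)) y
        - ∑ l, ∑ i, partialD l (partialD i (w ∘ φ.symm)) y ^ 2
        - ∑ i, ∑ j, (ricci g φ i j y + hessian g φ f i j y)
          * partialD i (w ∘ φ.symm) y * partialD j (w ∘ φ.symm) y := by
  have hW2 : ContDiffAt ℝ 2 (w ∘ φ.symm) y := hw.of_le (by norm_num)
  have hR := h.ricci_quadratic fun i => partialD i (w ∘ φ.symm) y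
  have sW : ∀ i l, partialD i (partialD l (w ∘ φ.symm)) y
      = partialD l (partialD i (w ∘ φ.symm)) y := fun i l => partialD_comm hW2
  have s3 : ∀ i l, partialD l (partialD i (partialD i (w ∘ φ.symm))) y
      = partialD i (partialD i (partialD l (w ∘ φ.symm))) y := by
    intro i l
    rw [partialD_comm (contDiffAt_partialD hw (by norm_num))]
    refine partialD_congr ?_
    filter_upwards [hw.eventually (by simp)] with z hz
    exact partialD_comm (hz.of_le (by norm_num))
  -- Both sides are now expanded at the centre. Third derivatives of `w` match by `s3`, the second
  -- derivatives of the metric combine through `hR`, and `t1` to `t6` only relabel sums and use the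
  -- symmetry of second derivatives.
  simp only [h.partialD_coordFLaplacian hw hf, h.partialD_partialD_coordGradInner_self hw,
    h.partialD_coordGradInner hW2 hW2, add_mul, Finset.sum_add_distrib, hR, hessian,
    h.christoffel_eq, zero_mul, Finset.sum_const_zero, sub_zero, mul_sub, mul_add,
    Finset.mul_sum, Finset.sum_sub_distrib]
  set W := w ∘ φ.symm
  set F := f ∘ φ.symm
  have t1 : ∑ x, ∑ i, partialD x W y * partialD x (partialD i (partialD i W)) y
      = ∑ x, ∑ i, 1 / 2 * (2 * (partialD x (partialD x (partialD i W)) y * partialD i W y)) := by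
    rw [Finset.sum_comm]
    refine Finset.sum_congr rfl fun i _ => Finset.sum_congr rfl fun x _ => ?_
    rw [s3]; ring
  have t2 : ∑ x, ∑ i, ∑ k, partialD x W y * (partialD x (christoffel g φ k i i) y * partialD k W y)
      = ∑ i, ∑ x, ∑ k, partialD x (christoffel g φ k i i) y * partialD k W y * partialD x W y := by
    rw [Finset.sum_comm]
    refine Finset.sum_congr rfl fun i _ => Finset.sum_congr rfl fun x _ =>
      Finset.sum_congr rfl fun k _ => by ring
  have t3 : ∑ x, ∑ i, partialD x W y * (partialD x (partialD i F) y * partialD i W y)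
      = ∑ x, ∑ i, partialD x (partialD i F) y * partialD x W y * partialD i W y :=
    Finset.sum_congr rfl fun x _ => Finset.sum_congr rfl fun i _ => by ring
  have t4 : ∑ x, ∑ i, partialD x W y * (partialD i F y * partialD x (partialD i W) y)
      = ∑ x, ∑ i, 1 / 2 * (partialD x F y * (partialD x (partialD i W) y * partialD i W y))
      + ∑ x, ∑ i, 1 / 2 * (partialD x F y * (partialD i W y * partialD x (partialD i W) y)) := by
    rw [Finset.sum_comm, ← Finset.sum_add_distrib]
    refine Finset.sum_congr rfl fun i _ => ?_
    rw [← Finset.sum_add_distrib]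
    refine Finset.sum_congr rfl fun x _ => ?_
    rw [sW x i]; ring
  have t5 : ∑ x, ∑ i, 1 / 2 * (2 * partialD x (partialD i W) y ^ 2)
      = ∑ x, ∑ i, partialD x (partialD i W) y ^ 2 :=
    Finset.sum_congr rfl fun x _ => Finset.sum_congr rfl fun i _ => by ring
  have t6 : ∑ x, ∑ i, ∑ k, 1 / 2 * -(partialD x (partialD x (metricComp g φ i k)) y
        * partialD i W y * partialD k W y)
      = -∑ x, ∑ i, ∑ k, 1 / 2 * (partialD x (partialD x (metricComp g φ i k)) y
        * partialD i W y * partialD k W y) := by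
    simp only [mul_neg, Finset.sum_neg_distrib]
  rw [t1, t2, t3, t4, t5, t6]
  ring

end NormalAt

end Normal

/-! ### First and second order conditions for `E α^β π^σ + Γ(α)` -/

theorem hasDerivAt_of_contDiffOn_Ioi {Γ : ℝ → ℝ} (hΓ : ContDiffOn ℝ 2 Γ (Set.Ioi 0)) {v : ℝ}
    (hv : 0 < v) : HasDerivAt Γ (deriv Γ v) v ∧ HasDerivAt (deriv Γ) (deriv (deriv Γ) v) v := by
  have hc : ContDiffAt ℝ 2 Γ v := hΓ.contDiffAt (Ioi_mem_nhds hv)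
  refine ⟨(hc.differentiableAt (by norm_num)).hasDerivAt, ?_⟩
  have : ContDiffAt ℝ 1 (deriv Γ) v := by
    have h2 : ContDiffAt ℝ 1 (fun x => fderiv ℝ Γ x 1) v :=
      (hc.fderiv_right (m := 1) (by norm_num)).clm_apply contDiffAt_const
    exact h2
  exact (this.differentiableAt (by norm_num)).hasDerivAt

/-- The two derivative tests along one coordinate line, with `α` in the role of `v` and `ρ` in that
of `|∇v|²`. Summing the second condition over the coordinate lines produces the Laplacian at the
centre of normal coordinates. -/
theorem isLocalMax_profile_line {Γ : ℝ → ℝ} (hΓ : ContDiffOn ℝ 2 Γ (Set.Ioi 0))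
    {α ρ α' ρ' : ℝ → ℝ} {a₂ b₂ E β σ x : ℝ}
    (hα : ∀ᶠ τ in nhds x, HasDerivAt α (α' τ) τ) (hρ : ∀ᶠ τ in nhds x, HasDerivAt ρ (ρ' τ) τ)
    (hα' : HasDerivAt α' a₂ x) (hρ' : HasDerivAt ρ' b₂ x) (hα0 : 0 < α x) (hρ0 : 0 < ρ x)
    (hmax : IsLocalMax (fun τ => E * (α τ ^ β * ρ τ ^ σ) + Γ (α τ)) x) :
    E * (β * α x ^ (β - 1) * ρ x ^ σ * α' x + σ * α x ^ β * ρ x ^ (σ - 1) * ρ' x)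
        + deriv Γ (α x) * α' x = 0 ∧
    E * (β * (β - 1) * α x ^ (β - 2) * ρ x ^ σ * α' x ^ 2
        + 2 * β * σ * α x ^ (β - 1) * ρ x ^ (σ - 1) * (α' x * ρ' x)
        + σ * (σ - 1) * α x ^ β * ρ x ^ (σ - 2) * ρ' x ^ 2
        + β * α x ^ (β - 1) * ρ x ^ σ * a₂ + σ * α x ^ β * ρ x ^ (σ - 1) * b₂)
      + deriv (deriv Γ) (α x) * α' x ^ 2 + deriv Γ (α x) * a₂ ≤ 0 := by
  have hα1 := hα.self_of_nhds
  have hρ1 := hρ.self_of_nhds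
  have pα := hα1.continuousAt.eventually (Ioi_mem_nhds hα0)
  have pρ := hρ1.continuousAt.eventually (Ioi_mem_nhds hρ0)
  have key : ∀ᶠ τ in nhds x, HasDerivAt (fun τ => E * (α τ ^ β * ρ τ ^ σ) + Γ (α τ))
      (E * (α' τ * β * α τ ^ (β - 1) * ρ τ ^ σ + α τ ^ β * (ρ' τ * σ * ρ τ ^ (σ - 1)))
        + deriv Γ (α τ) * α' τ) τ := by
    filter_upwards [hα, hρ, pα, pρ] with τ h1 h2 h3 h4
    have h3 : 0 < α τ := h3
    have h4 : 0 < ρ τ := h4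
    exact (((h1.rpow_const (Or.inl h3.ne')).mul (h2.rpow_const (Or.inl h4.ne'))).const_mul E).add
      ((hasDerivAt_of_contDiffOn_Ioi hΓ h3).1.comp τ h1)
  have A := fun p : ℝ => hα1.rpow_const (p := p) (Or.inl hα0.ne')
  have B := fun p : ℝ => hρ1.rpow_const (p := p) (Or.inl hρ0.ne')
  have hd := (((((hα'.mul_const β).mul (A (β - 1))).mul (B σ)).add
    ((A β).mul ((hρ'.mul_const σ).mul (B (σ - 1))))).const_mul E).add
    (((hasDerivAt_of_contDiffOn_Ioi hΓ hα0).2.comp x hα1).mul hα')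
  constructor
  · have := hmax.hasDerivAt_eq_zero key.self_of_nhds
    linear_combination this
  · have := second_deriv_nonpos_of_isLocalMax key hd hmax
    rw [show β - 1 - 1 = β - 2 by ring, show σ - 1 - 1 = σ - 2 by ring] at this
    simp only [Pi.mul_apply, Function.comp] at this
    refine le_of_eq_of_le ?_ this
    ring

/-! ### Linear algebra of the Hessian -/

/-- Since `K a = 0`, the trace of `K` equals its Hilbert-Schmidt product with the orthogonal
projection `π` onto `a^⊥`. That projection has squared norm `n - 1`, and Cauchy-Schwarz concludes.
-/
theorem sq_trace_le_of_mulVec_eq_zero {n : ℕ} {K : Fin n → Fin n → ℝ} {a : Fin n → ℝ}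
    (ha : 0 < ∑ i, a i ^ 2) (hK : ∀ i, ∑ j, K i j * a j = 0) :
    (∑ i, K i i) ^ 2 ≤ (∑ i, ∑ j, K i j ^ 2) * (n - 1) := by
  set P := ∑ i, a i ^ 2 with hP
  let π : Fin n → Fin n → ℝ := fun i j => (if i = j then 1 else 0) - a i * a j / P
  have hcs := Finset.sum_mul_sq_le_sq_mul_sq (Finset.univ : Finset (Fin n × Fin n))
    (fun p => K p.1 p.2) (fun p => π p.1 p.2)
  simp only [Fintype.sum_prod_type] at hcs
  have e1 : ∑ i, ∑ j, K i j * π i j = ∑ i, K i i := by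
    refine Finset.sum_congr rfl fun i _ => ?_
    have : ∀ j, K i j * π i j = (if i = j then K i j else 0) - a i / P * (K i j * a j) := by
      intro j
      simp only [π]
      split_ifs <;> ring
    simp only [this, Finset.sum_sub_distrib, ← Finset.mul_sum, hK, Finset.sum_ite_eq,
      Finset.mem_univ, if_true]
    ring
  have e2 : ∑ i, ∑ j, π i j ^ 2 = n - 1 := by
    have h1 : ∀ i, ∑ j, π i j ^ 2 = 1 - a i ^ 2 / P := by
      intro i
      have : ∀ j, π i j ^ 2 = (if i = j then 1 - 2 * (a i * a j) / P else 0)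
          + a i ^ 2 / P ^ 2 * a j ^ 2 := by
        intro j
        simp only [π]
        split_ifs <;> ring
      simp only [this, Finset.sum_add_distrib, ← Finset.mul_sum, ← hP, Finset.sum_ite_eq,
        Finset.mem_univ, if_true]
      field_simp
      ring
    simp only [h1, Finset.sum_sub_distrib, ← Finset.sum_div, ← hP]
    rw [div_self ha.ne']
    simp
  rwa [e1, e2] at hcs

/-- Removing the part `λ a⊗a/|a|²` leaves a matrix that kills `a`, whose trace is `tr h - λ` and
whose squared norm is `|h|² - λ²`. The trace inequality in dimension `n - 1` applies to it. The
drift `D` then enters by the weighted Cauchy-Schwarz inequality with weights `n - 1` and `m - n`,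
whose sum is `m - 1`. -/
theorem hessian_norm_sq_ge {n : ℕ} (hn : 2 ≤ n) {m : ℝ} (hm : (n : ℝ) ≤ m)
    {h : Fin n → Fin n → ℝ} {a : Fin n → ℝ} {lam D : ℝ} (ha : 0 < ∑ i, a i ^ 2)
    (heig : ∀ i, ∑ j, h i j * a j = lam * a i) (hD : m = n → D = 0) :
    lam ^ 2 + (∑ i, h i i - D - lam) ^ 2 / (m - 1)
      ≤ ∑ i, ∑ j, h i j ^ 2 + D ^ 2 / (m - n) := by
  set P := ∑ i, a i ^ 2 with hP
  have hn' : (2 : ℝ) ≤ n := by exact_mod_cast hn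
  have hk := sq_trace_le_of_mulVec_eq_zero (K := fun i j => h i j - lam * (a i * a j) / P) ha
    (by
      intro i
      have : ∀ j, (h i j - lam * (a i * a j) / P) * a j
          = h i j * a j - lam * a i / P * a j ^ 2 := by intro j; ring
      simp only [this, Finset.sum_sub_distrib, ← Finset.mul_sum, heig, ← hP]
      field_simp
      ring)
  have e1 : ∑ i, (h i i - lam * (a i * a i) / P) = ∑ i, h i i - lam := by
    have : ∀ i, h i i - lam * (a i * a i) / P = h i i - lam / P * a i ^ 2 := by intro i; ring
    simp only [this, Finset.sum_sub_distrib, ← Finset.mul_sum, ← hP]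
    field_simp
  have e2 : ∑ i, ∑ j, (h i j - lam * (a i * a j) / P) ^ 2 = ∑ i, ∑ j, h i j ^ 2 - lam ^ 2 := by
    have h1 : ∀ i, ∑ j, (h i j - lam * (a i * a j) / P) ^ 2
        = ∑ j, h i j ^ 2 - lam ^ 2 / P * a i ^ 2 := by
      intro i
      have : ∀ j, (h i j - lam * (a i * a j) / P) ^ 2
          = h i j ^ 2 - 2 * lam * a i / P * (h i j * a j)
            + lam ^ 2 * a i ^ 2 / P ^ 2 * a j ^ 2 := by intro j; ring
      simp only [this, Finset.sum_sub_distrib, Finset.sum_add_distrib, ← Finset.mul_sum, heig,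
        ← hP]
      field_simp
      ring
    simp only [h1, Finset.sum_sub_distrib, ← Finset.mul_sum, ← hP]
    field_simp
  simp only [e1, e2] at hk
  set τ := ∑ i, h i i - lam with hτ
  have hk' : τ ^ 2 / (n - 1) ≤ ∑ i, ∑ j, h i j ^ 2 - lam ^ 2 := by
    rw [div_le_iff₀ (by linarith)]; exact hk
  have hsplit : (∑ i, h i i - D - lam) ^ 2 / (m - 1) ≤ τ ^ 2 / (n - 1) + D ^ 2 / (m - n) := by
    rw [show ∑ i, h i i - D - lam = τ - D by rw [hτ]; ring]
    rcases hm.eq_or_lt with hmn | hmn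
    -- For `m = n` the drift vanishes and the quotient by `m - n` is `0` by convention, so both
    -- sides agree.
    · simp [hD hmn.symm, ← hmn]
    · rw [div_add_div _ _ (by linarith) (by linarith), div_le_div_iff₀ (by linarith)
        (mul_pos (by linarith) (by linarith))]
      nlinarith [sq_nonneg (τ * (m - n) + D * (n - 1))]
  linarith

/-- With this `β` one has `1 - 2qβ = -1/(s-1)`. Completing the squares in `Y` and in `Z` leaves a
multiple of `X²`, whose sign is governed by `s(s-1) - 1 - q²(s-1)³μ`. By the bound on `q` this is at
least `s - 2`, which is where `s ≥ 2` enters. -/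
theorem quadratic_form_nonpos {q s μ X Y Z : ℝ} (hs : 2 ≤ s) (hq : 0 < q) (hμ : 0 < μ)
    (hqμ : q ^ 2 * ((s - 1) * μ) ≤ 1) {β : ℝ} (hβ : β = s / (2 * (s - 1) * q)) :
    -q * β ^ 2 * X ^ 2 + s * (1 - 2 * q * β) * (X * Y) - q * s * (s - 1) * Y ^ 2
      + s * q * (X * Z) - s * q * (Z ^ 2 / μ) ≤ 0 := by
  set r := s - 1 with hr
  have hr1 : 1 ≤ r := by linarith
  have hs' : s = r + 1 := by linarith
  have e : -q * β ^ 2 * X ^ 2 + s * (1 - 2 * q * β) * (X * Y) - q * s * r * Y ^ 2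
      + s * q * (X * Z) - s * q * (Z ^ 2 / μ)
      = -(s * (q / μ * (Z - μ * X / 2) ^ 2 + q * r * (Y + X / (2 * q * r ^ 2)) ^ 2
        + X ^ 2 / (4 * q * r ^ 3) * (s * r - 1 - q ^ 2 * (r * μ) * r ^ 2))) := by
    rw [hβ, hs']
    field_simp
    ring
  rw [e]
  have h3 : 0 ≤ s * r - 1 - q ^ 2 * (r * μ) * r ^ 2 := by
    have : q ^ 2 * (r * μ) * r ^ 2 ≤ 1 * r ^ 2 := by gcongr
    rw [hs']
    nlinarith
  have : 0 ≤ s * (q / μ * (Z - μ * X / 2) ^ 2 + q * r * (Y + X / (2 * q * r ^ 2)) ^ 2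
        + X ^ 2 / (4 * q * r ^ 3) * (s * r - 1 - q ^ 2 * (r * μ) * r ^ 2)) := by positivity
  linarith

/-- The inequality between the derivatives of `c V² P² + Γ(V)` at a critical point: `L` stands for
`Δ_f V`, `LP` for `Δ_f P`, and `c` for `E V^(β-2) P^(σ-2)`. -/
theorem time_derivative_nonpos {q s k a V P L LP S Sv Sx Vt Pt lam A D2 c Γ₁ Γ₂ μ β : ℝ}
    (hs : 2 ≤ s) (hq : 0 < q) (hμ : 0 < μ) (hqμ : q ^ 2 * ((s - 1) * μ) ≤ 1)
    (hβ : β = s / (2 * (s - 1) * q)) (hV : 0 < V) (hP : 0 < P) (hc : 0 < c)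
    (hVt : Vt = q * V * L + P + S)
    (hPt : Pt / 2 ≤ k * P + q * V * (LP / 2) + q * P * L - q * V * (A + D2) + 2 * lam * P
      + Sx + Sv * P)
    (hA : lam ^ 2 + (L - lam) ^ 2 / μ ≤ A + D2)
    (hΓ₁ : Γ₁ = -(c * β * V * P ^ 2 + s * lam * c * V ^ 2 * P))
    (hsecond : c * (β * (β - 1) * P ^ 3 + 2 * β * s * lam * V * P ^ 2
      + s * (s - 2) * lam ^ 2 * V ^ 2 * P + β * V * P ^ 2 * L + s / 2 * V ^ 2 * P * LP)
      + Γ₂ * P + Γ₁ * L ≤ 0)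
    (h₁ : Γ₁ * S ≤ 0) (h₂ : 0 ≤ Γ₁ + V * Γ₂) (h₃ : Sx ≤ 0)
    (h₄ : Sv + S / (2 * (s - 1) * q * V) ≤ a) :
    c * (-(s * (k + a)) * V ^ 2 * P ^ 2 + β * V * P ^ 2 * Vt + s / 2 * V ^ 2 * P * Pt)
      + Γ₁ * Vt ≤ 0 := by
  have hquad := quadratic_form_nonpos (X := P) (Y := lam * V) (Z := V * (L - lam)) hs hq hμ hqμ hβ
  -- The reaction terms coming from `Vt` and from `Pt` add up to exactly the combination bounded by
  -- `a`.
  have hβ' : s * V * (S / (2 * (s - 1) * q * V)) = β * S := by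
    rw [hβ]
    have : s - 1 ≠ 0 := by linarith
    field_simp
  -- The factor `q V` is the diffusion coefficient of the pressure equation, so the terms with `LP`
  -- and `Γ₁ L` cancel against those of the time derivative.
  have i1 : 0 ≤ q * V * (-(c * (β * (β - 1) * P ^ 3 + 2 * β * s * lam * V * P ^ 2
      + s * (s - 2) * lam ^ 2 * V ^ 2 * P + β * V * P ^ 2 * L + s / 2 * V ^ 2 * P * LP)
      + Γ₂ * P + Γ₁ * L)) := mul_nonneg (by positivity) (by linarith)
  have i2 := mul_le_mul_of_nonneg_left hPt (show 0 ≤ c * s * V ^ 2 * P by positivity)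
  have i3 := mul_le_mul_of_nonneg_left hA (show 0 ≤ c * s * V ^ 2 * P * (q * V) by positivity)
  -- This trades the second derivative of `Γ` for the first, which `hΓ₁` then eliminates in favour
  -- of `lam`.
  have i4 : 0 ≤ q * P * (Γ₁ + V * Γ₂) := by positivity
  have i5 : c * s * V ^ 2 * P * Sx ≤ 0 := mul_nonpos_of_nonneg_of_nonpos (by positivity) h₃
  have i6 := mul_le_mul_of_nonneg_left h₄ (show 0 ≤ c * V * P ^ 2 * (s * V) by positivity)
  have i7 : c * V * P * (-q * β ^ 2 * P ^ 2 + s * (1 - 2 * q * β) * (P * (lam * V))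
      - q * s * (s - 1) * (lam * V) ^ 2 + s * q * (P * (V * (L - lam)))
      - s * q * ((V * (L - lam)) ^ 2 / μ)) ≤ 0 :=
    mul_nonpos_of_nonneg_of_nonpos (by positivity) hquad
  have i8 : c * V * P ^ 2 * (s * V) * (Sv + S / (2 * (s - 1) * q * V))
      = c * s * V ^ 2 * P ^ 2 * Sv + c * V * P ^ 2 * (β * S) := by
    rw [← hβ']; ring
  rw [i8] at i6
  rw [hVt]
  rw [hΓ₁] at i1 i4 h₁ ⊢
  rw [div_eq_mul_inv] at i3 i7
  linarith

section Charts

variable {n : ℕ} {M : Type*} [TopologicalSpace M] [ChartedSpace (EuclideanSpace ℝ (Fin n)) M]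

/-! ### The coordinate frame -/

section Frame

variable {g : Metric n M} {φ : OpenPartialHomeomorph M (EuclideanSpace ℝ (Fin n))}
  {y : EuclideanSpace ℝ (Fin n)}

theorem mdifferentiable_of_mem_maximalAtlas (hφ : φ ∈ IsManifold.maximalAtlas (𝓡 n) ∞ M) :
    φ.MDifferentiable (𝓡 n) (𝓡 n) :=
  ⟨(contMDiffOn_of_mem_maximalAtlas hφ).mdifferentiableOn (by simp),
    (contMDiffOn_symm_of_mem_maximalAtlas hφ).mdifferentiableOn (by simp)⟩

theorem sum_smul_coordVector (ξ : Fin n → ℝ) :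
    ∑ i, ξ i • coordVector φ i y
      = mfderiv (𝓡 n) (𝓡 n) φ.symm y (WithLp.toLp 2 ξ : EuclideanSpace ℝ (Fin n)) := by
  have h : (WithLp.toLp 2 ξ : EuclideanSpace ℝ (Fin n))
      = ∑ i, ξ i • EuclideanSpace.single i (1 : ℝ) := by
    ext j
    simp [Finset.sum_apply, Pi.single_apply]
  rw [h]
  unfold coordVector
  erw [map_sum]
  refine Finset.sum_congr rfl fun i _ => ?_
  erw [map_smul]

theorem exists_sum_smul_coordVector (hφ : φ ∈ IsManifold.maximalAtlas (𝓡 n) ∞ M)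
    (hy : y ∈ φ.target) (X : TangentSpace (𝓡 n) (φ.symm y)) :
    ∃ ξ : Fin n → ℝ, X = ∑ i, ξ i • coordVector φ i y := by
  obtain ⟨z, hz⟩ := (mdifferentiable_of_mem_maximalAtlas hφ).symm.mfderiv_surjective
    (x := y) hy X
  change EuclideanSpace ℝ (Fin n) at z
  refine ⟨fun i => z i, ?_⟩
  rw [sum_smul_coordVector]
  exact hz.symm

theorem inner_sum_sum (ξ η : Fin n → ℝ) :
    g.inner (φ.symm y) (∑ i, ξ i • coordVector φ i y) (∑ j, η j • coordVector φ j y)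
      = ∑ i, ∑ j, metricComp g φ i j y * ξ i * η j := by
  simp only [map_sum, map_smul, sum_apply, smul_apply,
    smul_eq_mul, metricComp]
  simp only [Finset.mul_sum]
  rw [Finset.sum_comm]
  refine Finset.sum_congr rfl fun i _ => Finset.sum_congr rfl fun j _ => by ring

theorem metricComp_pos (hφ : φ ∈ IsManifold.maximalAtlas (𝓡 n) ∞ M) (hy : y ∈ φ.target)
    {ξ : Fin n → ℝ} (hξ : ξ ≠ 0) : 0 < ∑ i, ∑ j, metricComp g φ i j y * ξ i * ξ j := by
  rw [← inner_sum_sum]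
  refine g.pos _ _ fun h => hξ ?_
  rw [sum_smul_coordVector] at h
  have := (mdifferentiable_of_mem_maximalAtlas hφ).symm.mfderiv_injective (x := y) hy
    (h.trans (map_zero _).symm)
  funext i
  exact congrArg (fun z : EuclideanSpace ℝ (Fin n) => z i) this

theorem det_metricComp_ne_zero (hφ : φ ∈ IsManifold.maximalAtlas (𝓡 n) ∞ M)
    (hy : y ∈ φ.target) : (Matrix.of fun a b => metricComp g φ a b y).det ≠ 0 := by
  intro h
  obtain ⟨ξ, hξ, h0⟩ := Matrix.exists_mulVec_eq_zero_iff.2 h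
  have hpos := metricComp_pos (g := g) hφ hy hξ
  have : ∑ i, ∑ j, metricComp g φ i j y * ξ i * ξ j = 0 := by
    refine Finset.sum_eq_zero fun i _ => ?_
    have h1 := congrFun h0 i
    simp only [Matrix.mulVec, dotProduct, Matrix.of_apply, Pi.zero_apply] at h1
    calc ∑ j, metricComp g φ i j y * ξ i * ξ j = ξ i * ∑ j, metricComp g φ i j y * ξ j := by
          rw [Finset.mul_sum]; exact Finset.sum_congr rfl fun j _ => by ring
      _ = 0 := by rw [h1, mul_zero]
  linarith

theorem differential_coordVector (hφ : φ ∈ IsManifold.maximalAtlas (𝓡 n) ∞ M)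
    (hy : y ∈ φ.target) {w : M → ℝ} (hw : MDifferentiableAt (𝓡 n) 𝓘(ℝ, ℝ) w (φ.symm y))
    (i : Fin n) : differential w (φ.symm y) (coordVector φ i y) = partialD i (w ∘ φ.symm) y := by
  have h1 := (mdifferentiable_of_mem_maximalAtlas hφ).mdifferentiableAt_symm hy
  have h2 := mfderiv_comp y hw h1
  unfold partialD differential coordVector
  rw [← mfderiv_eq_fderiv, h2]
  rfl

/-- The coefficients of the gradient in the coordinate frame solve the linear system with matrix
`g_ij` and right-hand side `∂_i z`; inverting the matrix raises the index. -/
theorem gradInner_eq_coordGradInner (hφ : φ ∈ IsManifold.maximalAtlas (𝓡 n) ∞ M)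
    (hy : y ∈ φ.target) {w z : M → ℝ} (hw : MDifferentiableAt (𝓡 n) 𝓘(ℝ, ℝ) w (φ.symm y))
    (hz : MDifferentiableAt (𝓡 n) 𝓘(ℝ, ℝ) z (φ.symm y)) :
    gradInner g w z (φ.symm y) = coordGradInner g φ (w ∘ φ.symm) (z ∘ φ.symm) y := by
  obtain ⟨c, hc⟩ := exists_sum_smul_coordVector hφ hy (gradient g z (φ.symm y))
  have hzc : ∀ i, partialD i (z ∘ φ.symm) y = ∑ j, metricComp g φ i j y * c j := by
    intro i
    rw [← differential_coordVector hφ hy hz, ← inner_gradient g z, hc]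
    simp only [map_sum, map_smul, sum_apply, smul_apply,
      smul_eq_mul]
    refine Finset.sum_congr rfl fun j _ => ?_
    rw [mul_comm, metricComp_symm]
    rfl
  have hcz : ∀ i, ∑ j, metricInv g φ i j y * partialD j (z ∘ φ.symm) y = c i := by
    intro i
    set A := Matrix.of fun a b => metricComp g φ a b y with hA
    have h1 : A.mulVec c = fun i => partialD i (z ∘ φ.symm) y := by
      funext i
      rw [hzc i]
      rfl
    have h2 : A⁻¹.mulVec (A.mulVec c) = c := by
      rw [Matrix.mulVec_mulVec, Matrix.nonsing_inv_mul _
        (isUnit_iff_ne_zero.2 (det_metricComp_ne_zero hφ hy)), Matrix.one_mulVec]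
    rw [h1] at h2
    exact congrFun h2 i
  unfold gradInner coordGradInner
  rw [inner_gradient, hc, map_sum]
  refine Finset.sum_congr rfl fun i _ => ?_
  rw [map_smul, differential_coordVector hφ hy hw, smul_eq_mul, ← hcz i, Finset.sum_mul]
  exact Finset.sum_congr rfl fun j _ => by ring

end Frame

/-! ### Smoothness in coordinates -/

section Smoothness

variable {φ : OpenPartialHomeomorph M (EuclideanSpace ℝ (Fin n))}

theorem SpaceTimeContMDiff.contDiffOn {r : WithTop ℕ∞} {T : ℝ} {w : ℝ → M → ℝ} (hr : r ≤ ∞)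
    (hw : SpaceTimeContMDiff n r T w) (hφ : φ ∈ IsManifold.maximalAtlas (𝓡 n) ∞ M) :
    ContDiffOn ℝ r (fun q : ℝ × EuclideanSpace ℝ (Fin n) => w q.1 (φ.symm q.2))
      (Set.Icc 0 T ×ˢ φ.target) := by
  rw [← contMDiffOn_iff_contDiffOn]
  have h1 : ContMDiffOn 𝓘(ℝ, ℝ × EuclideanSpace ℝ (Fin n)) (𝓘(ℝ, ℝ).prod (𝓡 n)) r
      (fun q : ℝ × EuclideanSpace ℝ (Fin n) => (q.1, φ.symm q.2))
      (Set.Icc 0 T ×ˢ φ.target) := by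
    refine ContMDiffOn.prodMk contDiff_fst.contMDiff.contMDiffOn ?_
    exact ((contMDiffOn_symm_of_mem_maximalAtlas hφ).of_le hr).comp
      contDiff_snd.contMDiff.contMDiffOn fun q hq => hq.2
  exact ContMDiffOn.comp hw h1 fun q hq => ⟨hq.1, Set.mem_univ _⟩

theorem SpaceTimeContMDiff.mdifferentiableAt {r : WithTop ℕ∞} {T : ℝ} {w : ℝ → M → ℝ}
    (hr : r ≠ 0) (hw : SpaceTimeContMDiff n r T w) {t : ℝ} (ht : t ∈ Set.Icc 0 T) (x : M) :
    MDifferentiableAt (𝓡 n) 𝓘(ℝ, ℝ) (w t) x := by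
  have h1 : ContMDiff (𝓡 n) (𝓘(ℝ, ℝ).prod (𝓡 n)) r (fun x : M => (t, x)) :=
    contMDiff_const.prodMk contMDiff_id
  have h2 : ContMDiffOn (𝓡 n) 𝓘(ℝ, ℝ) r (w t) Set.univ :=
    ContMDiffOn.comp (I' := 𝓘(ℝ, ℝ).prod (𝓡 n)) (g := fun q : ℝ × M => w q.1 q.2)
      (t := Set.Icc 0 T ×ˢ Set.univ) hw h1.contMDiffOn fun x _ => ⟨ht, Set.mem_univ _⟩
  exact (contMDiffOn_univ.1 h2).contMDiffAt.mdifferentiableAt hr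

end Smoothness

/-! ### Existence of normal coordinates -/

section NormalCoordinates

open scoped MatrixOrder in
-- The inverse of the positive square root of `A` does this. It provides the linear change of
-- coordinates that makes the metric the identity at a point.
theorem exists_transpose_mul_mul_eq_one {A : Matrix (Fin n) (Fin n) ℝ} (hA : A.PosDef) :
    ∃ L : Matrix (Fin n) (Fin n) ℝ, L.transpose * A * L = 1 ∧ IsUnit L.det := by
  have h0 : 0 ≤ A := Matrix.nonneg_iff_posSemidef.2 hA.posSemidef
  have h1 := CFC.sqrt_mul_sqrt_self A h0
  have h2 : (CFC.sqrt A).transpose = CFC.sqrt A := by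
    have := (Matrix.nonneg_iff_posSemidef.1 (CFC.sqrt_nonneg A)).isHermitian
    simpa [Matrix.IsHermitian] using this
  set B := CFC.sqrt A
  have hB : IsUnit B.det := by
    have hd : IsUnit A.det := hA.det_pos.ne'.isUnit
    rw [← h1, Matrix.det_mul] at hd
    exact isUnit_of_mul_isUnit_left hd
  refine ⟨B⁻¹, ?_, by rw [Matrix.det_nonsing_inv]; exact hB.ringInverse⟩
  rw [Matrix.transpose_nonsing_inv, h2, ← h1, ← Matrix.mul_assoc, Matrix.nonsing_inv_mul _ hB,
    Matrix.one_mul, Matrix.mul_nonsing_inv _ hB]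

variable [IsManifold (𝓡 n) ∞ M]

/-- Composing a chart with a local diffeomorphism of the coordinate space. -/
theorem exists_chart_comp {φ₀ : OpenPartialHomeomorph M (EuclideanSpace ℝ (Fin n))}
    (hφ₀ : φ₀ ∈ IsManifold.maximalAtlas (𝓡 n) ∞ M)
    {ψ : EuclideanSpace ℝ (Fin n) → EuclideanSpace ℝ (Fin n)} (hψ : ContDiff ℝ ∞ ψ)
    (h0 : ψ 0 ∈ φ₀.target) (hinj : Function.Injective (fderiv ℝ ψ 0)) :
    ∃ φ ∈ IsManifold.maximalAtlas (𝓡 n) ∞ M, (0 : EuclideanSpace ℝ (Fin n)) ∈ φ.target ∧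
      φ.symm 0 = φ₀.symm (ψ 0) ∧ ∀ (g : Metric n M) (i j : Fin n), ∀ z ∈ φ.target,
        metricComp g φ i j z = ∑ a, ∑ b, metricComp g φ₀ a b (ψ z)
          * partialD i (fun z => ψ z a) z * partialD j (fun z => ψ z b) z := by
  let ψ' : EuclideanSpace ℝ (Fin n) ≃L[ℝ] EuclideanSpace ℝ (Fin n) :=
    (LinearEquiv.ofInjectiveEndo (fderiv ℝ ψ 0).toLinearMap hinj).toContinuousLinearEquiv
  have hψ' : HasFDerivAt ψ (ψ' : EuclideanSpace ℝ (Fin n) →L[ℝ] EuclideanSpace ℝ (Fin n)) 0 := by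
    rw [show (ψ' : EuclideanSpace ℝ (Fin n) →L[ℝ] EuclideanSpace ℝ (Fin n)) = fderiv ℝ ψ 0 from
      ContinuousLinearMap.ext fun _ => rfl]
    exact (hψ.differentiable (by simp) _).hasFDerivAt
  -- The inverse function theorem gives smoothness of the inverse near `ψ 0` only. Restricting to
  -- the open set where the derivative of `ψ` is invertible makes the local inverse smooth on its
  -- whole target, as membership in the maximal atlas requires.
  let R : Set (EuclideanSpace ℝ (Fin n)) := fderiv ℝ ψ ⁻¹' Set.range
    ((↑) : (EuclideanSpace ℝ (Fin n) ≃L[ℝ] EuclideanSpace ℝ (Fin n)) →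
      EuclideanSpace ℝ (Fin n) →L[ℝ] EuclideanSpace ℝ (Fin n))
  have hR : IsOpen R := ContinuousLinearEquiv.isOpen.preimage (hψ.continuous_fderiv (by simp))
  let Ψ := (hψ.contDiffAt.toOpenPartialHomeomorph ψ hψ' (by simp)).restrOpen R hR
  have hΨ : ∀ z, Ψ z = ψ z := fun _ => rfl
  have hΨs : ContDiffOn ℝ ∞ Ψ.symm Ψ.target := by
    intro z hz
    have hz' : Ψ.symm z ∈ Ψ.source := Ψ.map_target hz
    obtain ⟨e, he⟩ : Ψ.symm z ∈ R := hz'.2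
    refine (Ψ.contDiffAt_symm (f₀' := e) hz ?_ hψ.contDiffAt).contDiffWithinAt
    rw [he]
    exact (hψ.differentiable (by simp) _).hasFDerivAt
  have h0s : (0 : EuclideanSpace ℝ (Fin n)) ∈ Ψ.source :=
    ⟨hψ.contDiffAt.mem_toOpenPartialHomeomorph_source hψ' (by simp), ψ', hψ'.fderiv.symm⟩
  let φ := φ₀.trans Ψ.symm
  have ht : ∀ z ∈ φ.target, z ∈ Ψ.source ∧ ψ z ∈ φ₀.target := by
    intro z hz
    simpa [φ, hΨ] using hz
  have hφ : φ ∈ IsManifold.maximalAtlas (𝓡 n) ∞ M := by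
    refine φ.mem_maximalAtlas_of_contMDiffOn ?_ ?_
    · refine ContMDiffOn.comp (t := Ψ.target) hΨs.contMDiffOn
        ((contMDiffOn_of_mem_maximalAtlas hφ₀).mono ?_) ?_
      · intro x hx
        have : x ∈ φ₀.source ∧ φ₀ x ∈ Ψ.target := by simpa [φ] using hx
        exact this.1
      · intro x hx
        have : x ∈ φ₀.source ∧ φ₀ x ∈ Ψ.target := by simpa [φ] using hx
        exact this.2
    · exact ContMDiffOn.comp (t := φ₀.target) (f := ψ) (contMDiffOn_symm_of_mem_maximalAtlas hφ₀)
        hψ.contMDiff.contMDiffOn fun z hz => (ht z hz).2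
  refine ⟨φ, hφ, ?_, rfl, ?_⟩
  · have : (0 : EuclideanSpace ℝ (Fin n)) ∈ Ψ.source ∧ ψ 0 ∈ φ₀.target := ⟨h0s, h0⟩
    simpa [φ, hΨ] using this
  · intro g i j z hz
    have hd : DifferentiableAt ℝ ψ z := hψ.differentiable (by simp) z
    have hc : ∀ i, coordVector φ i z
        = ∑ a, partialD i (fun z => ψ z a) z • coordVector φ₀ a (ψ z) := by
      intro i
      rw [sum_smul_coordVector (φ := φ₀) (y := ψ z)]
      have h1 := (mdifferentiable_of_mem_maximalAtlas hφ₀).mdifferentiableAt_symm (ht z hz).2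
      have h2 := mfderiv_comp z h1 hd.mdifferentiableAt
      have h3 : (WithLp.toLp 2 fun a => partialD i (fun z => ψ z a) z : EuclideanSpace ℝ (Fin n))
          = fderiv ℝ ψ z (EuclideanSpace.single i 1) := by
        ext a
        have : HasFDerivAt (fun z => ψ z a) ((EuclideanSpace.proj a).comp (fderiv ℝ ψ z)) z :=
          (EuclideanSpace.proj (𝕜 := ℝ) a).hasFDerivAt.comp z hd.hasFDerivAt
        simp [partialD, this.fderiv]
      rw [h3]
      unfold coordVector
      change mfderiv (𝓡 n) (𝓡 n) (φ₀.symm ∘ ψ) z _ = _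
      rw [h2, mfderiv_eq_fderiv]
      rfl
    unfold metricComp
    rw [hc i, hc j]
    exact inner_sum_sum (φ := φ₀) (y := ψ z) _ _

/-- The polynomial map `z ↦ y₀ + L z + q(z, z) / 2`. -/
def quadraticMap (y₀ : EuclideanSpace ℝ (Fin n)) (L : Matrix (Fin n) (Fin n) ℝ)
    (q : Fin n → Fin n → Fin n → ℝ) (z : EuclideanSpace ℝ (Fin n)) : EuclideanSpace ℝ (Fin n) :=
  WithLp.toLp 2 fun a => y₀ a + ∑ i, L a i * z i + ∑ b, ∑ c, q a b c / 2 * (z b * z c)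

section QuadraticMap

variable {y₀ : EuclideanSpace ℝ (Fin n)} {L : Matrix (Fin n) (Fin n) ℝ}
  {q : Fin n → Fin n → Fin n → ℝ}

theorem quadraticMap_zero : quadraticMap y₀ L q 0 = y₀ := by
  ext a
  simp [quadraticMap]

theorem contDiff_coord (i : Fin n) : ContDiff ℝ ∞ fun z : EuclideanSpace ℝ (Fin n) => z i :=
  (EuclideanSpace.proj (𝕜 := ℝ) i).contDiff

theorem differentiableAt_coord (i : Fin n) {z : EuclideanSpace ℝ (Fin n)} :
    DifferentiableAt ℝ (fun z : EuclideanSpace ℝ (Fin n) => z i) z :=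
  (contDiff_coord i).differentiable (by simp) z

theorem partialD_coord (i j : Fin n) (z : EuclideanSpace ℝ (Fin n)) :
    partialD i (fun z : EuclideanSpace ℝ (Fin n) => z j) z = if j = i then 1 else 0 := by
  have := ((EuclideanSpace.proj (𝕜 := ℝ) j).hasFDerivAt (x := z)).fderiv
  change fderiv ℝ (EuclideanSpace.proj (𝕜 := ℝ) j) z _ = _
  rw [this]
  simp

theorem contDiff_quadraticMap : ContDiff ℝ ∞ (quadraticMap y₀ L q) := by
  rw [contDiff_euclidean]
  intro a
  have h := contDiff_coord (n := n)
  refine (contDiff_const.add (ContDiff.sum fun i _ => contDiff_const.mul (h i))).add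
    (ContDiff.sum fun b _ => ContDiff.sum fun c _ => contDiff_const.mul ((h b).mul (h c)))

theorem partialD_quadraticMap (hq : ∀ a b c, q a b c = q a c b) (i a : Fin n)
    (z : EuclideanSpace ℝ (Fin n)) :
    partialD i (fun z => quadraticMap y₀ L q z a) z = L a i + ∑ c, q a i c * z c := by
  have d := fun i : Fin n => differentiableAt_coord i (z := z)
  have d1 : ∀ i, DifferentiableAt ℝ (fun z : EuclideanSpace ℝ (Fin n) => L a i * z i) z :=
    fun i => (d i).const_mul _
  have d2 : ∀ b c, DifferentiableAt ℝ
      (fun z : EuclideanSpace ℝ (Fin n) => q a b c / 2 * (z b * z c)) z :=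
    fun b c => ((d b).fun_mul (d c)).const_mul _
  change partialD i (fun z : EuclideanSpace ℝ (Fin n) =>
    y₀ a + ∑ i, L a i * z i + ∑ b, ∑ c, q a b c / 2 * (z b * z c)) z = _
  rw [partialD_add ((differentiableAt_const _).fun_add (DifferentiableAt.fun_sum fun i _ => d1 i))
    (DifferentiableAt.fun_sum fun b _ => DifferentiableAt.fun_sum fun c _ => d2 b c),
    partialD_add (differentiableAt_const _) (DifferentiableAt.fun_sum fun i _ => d1 i),
    partialD_const, partialD_sum fun i _ => d1 i,
    partialD_sum fun b _ => DifferentiableAt.fun_sum fun c _ => d2 b c]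
  have e : ∀ b, partialD i (fun z : EuclideanSpace ℝ (Fin n) => ∑ c, q a b c / 2 * (z b * z c)) z
      = (if b = i then ∑ c, q a b c / 2 * z c else 0) + q a b i / 2 * z b := by
    intro b
    rw [partialD_sum fun c _ => d2 b c]
    have e' : ∀ c, partialD i (fun z : EuclideanSpace ℝ (Fin n) => q a b c / 2 * (z b * z c)) z
        = (if b = i then q a b c / 2 * z c else 0) + if c = i then q a b c / 2 * z b else 0 := by
      intro c
      rw [partialD_const_mul _ ((d b).fun_mul (d c)), partialD_mul (d b) (d c), partialD_coord,
        partialD_coord]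
      split_ifs <;> ring
    simp only [e', Finset.sum_add_distrib, Finset.sum_ite_eq', Finset.mem_univ, if_true]
    split_ifs <;> simp
  have e1 : ∀ j, partialD i (fun z : EuclideanSpace ℝ (Fin n) => L a j * z j) z
      = if j = i then L a j else 0 := by
    intro j
    rw [partialD_const_mul _ (d j), partialD_coord]
    split_ifs <;> ring
  simp only [e, e1, Finset.sum_add_distrib, Finset.sum_ite_eq', Finset.mem_univ, if_true, zero_add]
  rw [← Finset.sum_add_distrib]
  congr 1
  refine Finset.sum_congr rfl fun c _ => ?_
  rw [hq a c i]
  ring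

theorem injective_fderiv_quadraticMap (hq : ∀ a b c, q a b c = q a c b) (hL : IsUnit L.det) :
    Function.Injective (fderiv ℝ (quadraticMap y₀ L q) 0) := by
  have hd : DifferentiableAt ℝ (quadraticMap y₀ L q) 0 :=
    contDiff_quadraticMap.differentiable (by simp) _
  have key : ∀ w, (fderiv ℝ (quadraticMap y₀ L q) 0 w).ofLp = L.mulVec w.ofLp := by
    intro w
    have hw : w = ∑ i, w i • EuclideanSpace.single i (1 : ℝ) := by
      ext j
      simp [Finset.sum_apply, Pi.single_apply]
    funext a
    have h1 : HasFDerivAt (fun z => quadraticMap y₀ L q z a)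
        ((EuclideanSpace.proj a).comp (fderiv ℝ (quadraticMap y₀ L q) 0)) 0 :=
      (EuclideanSpace.proj (𝕜 := ℝ) a).hasFDerivAt.comp _ hd.hasFDerivAt
    have h2 : ∀ i, fderiv ℝ (quadraticMap y₀ L q) 0 (EuclideanSpace.single i 1) a = L a i := by
      intro i
      have := partialD_quadraticMap (y₀ := y₀) (L := L) hq i a 0
      rw [partialD, h1.fderiv] at this
      simpa using this
    conv_lhs => rw [hw]
    simp only [map_sum, map_smul, WithLp.ofLp_sum, WithLp.ofLp_smul, Finset.sum_apply,
      Pi.smul_apply, h2, smul_eq_mul, Matrix.mulVec, dotProduct]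
    exact Finset.sum_congr rfl fun i _ => mul_comm _ _
  rw [injective_iff_map_eq_zero]
  intro w hw
  have h := key w
  rw [hw] at h
  have h3 : w.ofLp = 0 := by
    have := congrArg (L⁻¹.mulVec) h
    rw [Matrix.mulVec_mulVec, Matrix.nonsing_inv_mul _ hL, Matrix.one_mulVec] at this
    rw [← this]
    exact Matrix.mulVec_zero _
  ext i
  exact congrFun h3 i

end QuadraticMap

theorem exists_orthonormal_chart {φ₀ : OpenPartialHomeomorph M (EuclideanSpace ℝ (Fin n))}
    (hφ₀ : φ₀ ∈ IsManifold.maximalAtlas (𝓡 n) ∞ M) {y₀ : EuclideanSpace ℝ (Fin n)}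
    (hy₀ : y₀ ∈ φ₀.target) (g : Metric n M) :
    ∃ φ ∈ IsManifold.maximalAtlas (𝓡 n) ∞ M, (0 : EuclideanSpace ℝ (Fin n)) ∈ φ.target ∧
      φ.symm 0 = φ₀.symm y₀ ∧ ∀ i j, metricComp g φ i j 0 = if i = j then 1 else 0 := by
  have hA : (Matrix.of fun a b => metricComp g φ₀ a b y₀).PosDef := by
    refine Matrix.PosDef.of_dotProduct_mulVec_pos ?_ fun ξ hξ => ?_
    · ext i j
      simp [metricComp_symm i j]
    · have := metricComp_pos (g := g) hφ₀ hy₀ hξ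
      refine this.trans_eq ?_
      simp only [dotProduct, Matrix.mulVec, Matrix.of_apply, Finset.mul_sum, star_trivial]
      exact Finset.sum_congr rfl fun i _ => Finset.sum_congr rfl fun j _ => by ring
  obtain ⟨L, hL, hdet⟩ := exists_transpose_mul_mul_eq_one hA
  have hq : ∀ a b c : Fin n, (fun _ _ _ => 0 : Fin n → Fin n → Fin n → ℝ) a b c
      = (fun _ _ _ => 0 : Fin n → Fin n → Fin n → ℝ) a c b := fun _ _ _ => rfl
  obtain ⟨φ, hφ, h0, h1, h2⟩ := exists_chart_comp hφ₀
    (contDiff_quadraticMap (y₀ := y₀) (L := L) (q := fun _ _ _ => 0))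
    (by rwa [quadraticMap_zero]) (injective_fderiv_quadraticMap hq hdet)
  refine ⟨φ, hφ, h0, by rw [h1, quadraticMap_zero], fun i j => ?_⟩
  rw [h2 g i j 0 h0, quadraticMap_zero]
  simp only [partialD_quadraticMap hq, zero_mul, Finset.sum_const_zero, add_zero]
  have := congrFun (congrFun hL i) j
  rw [Matrix.one_apply] at this
  rw [← this, Finset.sum_comm]
  simp only [Matrix.mul_apply, Matrix.transpose_apply, Matrix.of_apply, Finset.sum_mul]
  exact Finset.sum_congr rfl fun i _ => Finset.sum_congr rfl fun j _ => by ring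

/-- Around every point there is a chart in which the metric is standard to first order. -/
theorem exists_normalAt (g : Metric n M)
    (hg : ∀ φ ∈ IsManifold.maximalAtlas (𝓡 n) ∞ M, ∀ y ∈ φ.target, ∀ i j,
      ContDiffAt ℝ 2 (metricComp g φ i j) y) (x : M) :
    ∃ φ ∈ IsManifold.maximalAtlas (𝓡 n) ∞ M, x ∈ φ.source ∧ NormalAt g φ (φ x) := by
  obtain ⟨φ₁, hφ₁, h0, hx, h1⟩ := exists_orthonormal_chart (n := n) (M := M)
    (IsManifold.chart_mem_maximalAtlas x) (mem_chart_target (EuclideanSpace ℝ (Fin n)) x) g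
  rw [(chartAt (EuclideanSpace ℝ (Fin n)) x).left_inv (mem_chart_source _ x)] at hx
  set D : Fin n → Fin n → Fin n → ℝ := fun l i j => partialD l (metricComp g φ₁ i j) 0 with hD
  have sD : ∀ l i j, D l i j = D l j i := fun l i j => by simp only [hD, metricComp_symm i j]
  -- The negatives of the Christoffel symbols at the point, whose metric is already the identity
  -- there. They are chosen so that the quadratic change of coordinates cancels the first
  -- derivatives of the metric.
  set q : Fin n → Fin n → Fin n → ℝ := fun k i j => -(D i j k + D j i k - D k i j) / 2 with hqdef
  have hq : ∀ a b c, q a b c = q a c b := by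
    intro a b c
    simp only [hqdef, sD a b c]
    ring
  obtain ⟨φ, hφ, h0', hx', h2⟩ := exists_chart_comp hφ₁
    (contDiff_quadraticMap (y₀ := 0) (L := 1) (q := q))
    (by rwa [quadraticMap_zero]) (injective_fderiv_quadraticMap hq (by simp))
  rw [quadraticMap_zero, hx] at hx'
  have hxs : x ∈ φ.source := hx' ▸ φ.map_target h0'
  have hφx : φ x = 0 := by rw [← hx', φ.right_inv h0']
  refine ⟨φ, hφ, hxs, ?_⟩
  rw [hφx]
  refine ⟨fun i j => hg φ hφ 0 h0' i j, fun i j => ?_, fun l i j => ?_⟩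
  · rw [h2 g i j 0 h0', quadraticMap_zero]
    simp only [partialD_quadraticMap hq, h1]
    simp [Matrix.one_apply]
  · have e : metricComp g φ i j =ᶠ[nhds 0] fun z => ∑ a, ∑ b,
        metricComp g φ₁ a b (quadraticMap 0 1 q z)
          * (((1 : Matrix (Fin n) (Fin n) ℝ) a i + ∑ c, q a i c * z c)
            * ((1 : Matrix (Fin n) (Fin n) ℝ) b j + ∑ c, q b j c * z c)) := by
      filter_upwards [φ.open_target.mem_nhds h0'] with z hz
      rw [h2 g i j z hz]
      simp only [partialD_quadraticMap hq, mul_assoc]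
    have dψ : DifferentiableAt ℝ (quadraticMap 0 1 q) (0 : EuclideanSpace ℝ (Fin n)) :=
      contDiff_quadraticMap.differentiable (by simp) _
    have dA : ∀ a b, DifferentiableAt ℝ (metricComp g φ₁ a b) 0 := fun a b =>
      (hg φ₁ hφ₁ 0 h0 a b).differentiableAt (by norm_num)
    have dAq : ∀ a b, DifferentiableAt ℝ (metricComp g φ₁ a b) (quadraticMap 0 1 q 0) :=
      fun a b => by
        rw [quadraticMap_zero]
        exact dA a b
    have dA' : ∀ a b, DifferentiableAt ℝ
        (fun z => metricComp g φ₁ a b (quadraticMap 0 1 q z)) 0 := fun a b =>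
      (dAq a b).comp 0 dψ
    have pA : ∀ a b, partialD l (fun z => metricComp g φ₁ a b (quadraticMap 0 1 q z)) 0
        = D l a b := by
      intro a b
      have h3 : HasFDerivAt (fun z => metricComp g φ₁ a b (quadraticMap 0 1 q z))
          ((fderiv ℝ (metricComp g φ₁ a b) 0).comp (fderiv ℝ (quadraticMap 0 1 q) 0)) 0 := by
        have := (dAq a b).hasFDerivAt.comp 0 dψ.hasFDerivAt
        rw [quadraticMap_zero] at this
        exact this
      have h4 : fderiv ℝ (quadraticMap 0 1 q) 0 (EuclideanSpace.single l 1)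
          = EuclideanSpace.single l (1 : ℝ) := by
        ext c
        have h5 : HasFDerivAt (fun z => quadraticMap 0 1 q z c)
            ((EuclideanSpace.proj c).comp (fderiv ℝ (quadraticMap 0 1 q) 0)) 0 :=
          (EuclideanSpace.proj (𝕜 := ℝ) c).hasFDerivAt.comp _ dψ.hasFDerivAt
        have := partialD_quadraticMap (y₀ := 0) (L := 1) hq l c 0
        rw [partialD, h5.fderiv] at this
        simpa [Matrix.one_apply, Pi.single_apply] using this
      rw [partialD, h3.fderiv, ContinuousLinearMap.comp_apply, h4]
      rfl
    have dl : ∀ a i, DifferentiableAt ℝ (fun z : EuclideanSpace ℝ (Fin n) =>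
        (1 : Matrix (Fin n) (Fin n) ℝ) a i + ∑ c, q a i c * z c) 0 := fun a i =>
      (differentiableAt_const _).fun_add (DifferentiableAt.fun_sum fun c _ =>
        (differentiableAt_coord c).const_mul _)
    have pl : ∀ a i, partialD l (fun z : EuclideanSpace ℝ (Fin n) =>
        (1 : Matrix (Fin n) (Fin n) ℝ) a i + ∑ c, q a i c * z c) 0 = q a i l := by
      intro a i
      rw [partialD_add (differentiableAt_const _) (DifferentiableAt.fun_sum fun c _ =>
        (differentiableAt_coord c).const_mul _), partialD_const, partialD_sum fun c _ =>
        (differentiableAt_coord c).const_mul _]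
      simp only [partialD_const_mul _ (differentiableAt_coord _), partialD_coord]
      simp
    rw [partialD_congr e, partialD_sum fun a _ => DifferentiableAt.fun_sum fun b _ =>
      (dA' a b).fun_mul ((dl a i).fun_mul (dl b j))]
    have e2 : ∀ a, partialD l (fun z => ∑ b, metricComp g φ₁ a b (quadraticMap 0 1 q z)
          * (((1 : Matrix (Fin n) (Fin n) ℝ) a i + ∑ c, q a i c * z c)
            * ((1 : Matrix (Fin n) (Fin n) ℝ) b j + ∑ c, q b j c * z c))) 0
        = ∑ b, ((if b = j then if a = i then D l a b else 0 else 0)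
          + (if a = b then if a = j then q a i l else 0 else 0)
          + if a = b then if a = i then q b j l else 0 else 0) := by
      intro a
      rw [partialD_sum fun b _ => (dA' a b).fun_mul ((dl a i).fun_mul (dl b j))]
      refine Finset.sum_congr rfl fun b _ => ?_
      rw [partialD_mul (dA' a b) ((dl a i).fun_mul (dl b j)), partialD_mul (dl a i) (dl b j), pA,
        pl, pl, quadraticMap_zero, h1]
      simp only [Matrix.one_apply, PiLp.zero_apply, mul_zero, Finset.sum_const_zero, add_zero]
      rcases eq_or_ne a b with rfl | hab
      · simp only [if_true]
        split_ifs <;> ring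
      · simp only [if_neg hab]
        split_ifs <;> ring
    rw [Finset.sum_congr rfl fun a _ => e2 a]
    simp only [Finset.sum_add_distrib, Finset.sum_ite_eq, Finset.sum_ite_eq', Finset.mem_univ,
      if_true, hqdef]
    -- What remains is `D l i j + q j i l + q i j l = 0`, the compatibility of the Christoffel
    -- symbols with the metric.
    linear_combination (1 / 2 : ℝ) * sD j i l + (1 / 2 : ℝ) * sD i j l - (1 / 2 : ℝ) * sD l j i

end NormalCoordinates

end Charts

section Coordinates

variable {n : ℕ} {M : Type*} [TopologicalSpace M] [ChartedSpace (EuclideanSpace ℝ (Fin n)) M]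
  {φ : OpenPartialHomeomorph M (EuclideanSpace ℝ (Fin n))} {T : ℝ}

/-! ### Joint regularity of the gradient norm -/

section JointRegularity

variable {g : ℝ → Metric n M} {v : ℝ → M → ℝ}

theorem contDiffOn_metricInv (hg : MetricC2 T g) (hφ : φ ∈ IsManifold.maximalAtlas (𝓡 n) ∞ M)
    (i j : Fin n) : ContDiffOn ℝ 2
      (fun q : ℝ × EuclideanSpace ℝ (Fin n) => metricInv (g q.1) φ i j q.2)
      (Set.Icc 0 T ×ˢ φ.target) := fun q hq =>
  contDiffWithinAt_matrix_inv (A := fun q : ℝ × EuclideanSpace ℝ (Fin n) =>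
    Matrix.of fun a b => metricComp (g q.1) φ a b q.2) (fun i j => hg φ hφ i j q hq)
    (det_metricComp_ne_zero hφ hq.2) i j

theorem contDiffOn_coordGradInner (hT : 0 < T) (hg : MetricC2 T g)
    (hv : SpaceTimeContMDiff n ∞ T v) (hφ : φ ∈ IsManifold.maximalAtlas (𝓡 n) ∞ M) :
    ContDiffOn ℝ 2 (fun q : ℝ × EuclideanSpace ℝ (Fin n) =>
      coordGradInner (g q.1) φ (v q.1 ∘ φ.symm) (v q.1 ∘ φ.symm) q.2)
      (Set.Icc 0 T ×ˢ φ.target) := by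
  have hV := hv.contDiffOn le_rfl hφ
  have hVi := fun i => contDiffOn_partialD (r' := 2) hT φ.open_target hV (by norm_cast) i
  unfold coordGradInner
  exact ContDiffOn.sum fun i _ => ContDiffOn.sum fun j _ =>
    ((contDiffOn_metricInv hg hφ i j).mul (hVi i)).mul (hVi j)

theorem contDiffAt_metricComp (hg : MetricC2 T g) {t : ℝ} (ht : t ∈ Set.Icc 0 T)
    (hφ : φ ∈ IsManifold.maximalAtlas (𝓡 n) ∞ M) {y : EuclideanSpace ℝ (Fin n)}
    (hy : y ∈ φ.target) (i j : Fin n) : ContDiffAt ℝ 2 (metricComp (g t) φ i j) y :=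
  contDiffAt_slice φ.open_target (hg φ hφ i j) ht hy

/-- Where `g` is the identity, `∂_t g^ij = -∂_t g_ij`, hence the negative sign before the metric
term. Time and space derivatives of `v` commute at interior times. -/
theorem hasDerivAt_coordGradInner (hT : 0 < T) (hg : MetricC2 T g)
    (hv : SpaceTimeContMDiff n ∞ T v) (hφ : φ ∈ IsManifold.maximalAtlas (𝓡 n) ∞ M)
    {t : ℝ} (ht : t ∈ Set.Ioo 0 T) {y : EuclideanSpace ℝ (Fin n)} (hy : y ∈ φ.target)
    (hN : NormalAt (g t) φ y) :
    HasDerivAt (fun τ => coordGradInner (g τ) φ (v τ ∘ φ.symm) (v τ ∘ φ.symm) y)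
      (2 * ∑ i, partialD i (v t ∘ φ.symm) y
          * partialD i (fun z => deriv (fun τ => v τ (φ.symm z)) t) y
        - ∑ i, ∑ j, deriv (fun τ => metricComp (g τ) φ i j y) t
          * partialD i (v t ∘ φ.symm) y * partialD j (v t ∘ φ.symm) y) t := by
  have hV := hv.contDiffOn le_rfl hφ
  have hVc := contDiffAt_interior φ.open_target hV ht hy
  have hVi := fun i => contDiffAt_interior φ.open_target
    (contDiffOn_partialD (r' := 2) hT φ.open_target hV (by norm_cast) i) ht hy
  have hline : ∀ {K : ℝ × EuclideanSpace ℝ (Fin n) → ℝ}, ContDiffAt ℝ 2 K (t, y) →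
      ContDiffAt ℝ 2 (fun τ => K (τ, y)) t := fun {K} hK =>
    ContDiffAt.comp (f := fun τ : ℝ => (τ, y)) (g := K) t hK
      (contDiffAt_id.prodMk contDiffAt_const)
  have dV : ∀ i, HasDerivAt (fun τ => partialD i (v τ ∘ φ.symm) y)
      (partialD i (fun z => deriv (fun τ => v τ (φ.symm z)) t) y) t := by
    intro i
    rw [← deriv_partialD_comm (V := fun q => v q.1 (φ.symm q.2)) i
      (hVc.of_le (by norm_cast))]
    exact ((hline (hVi i)).differentiableAt (by norm_num)).hasDerivAt
  have dB : ∀ i j, HasDerivAt (fun τ => metricInv (g τ) φ i j y)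
      (-deriv (fun τ => metricComp (g τ) φ i j y) t) t := by
    intro i j
    refine hasDerivAt_matrix_inv (A := fun τ => Matrix.of fun a b => metricComp (g τ) φ a b y)
      (fun i j => ?_) hN.matrix_eq i j
    exact (hline (contDiffAt_interior φ.open_target (hg φ hφ i j) ht hy)).of_le (by norm_num)
  have := HasDerivAt.fun_sum (u := Finset.univ) fun i _ =>
    HasDerivAt.fun_sum (u := Finset.univ) fun j _ => ((dB i j).mul (dV i)).mul (dV j)
  refine this.congr_deriv ?_
  have e : ∀ i j, (-deriv (fun τ => metricComp (g τ) φ i j y) t * partialD i (v t ∘ φ.symm) y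
      + metricInv (g t) φ i j y * partialD i (fun z => deriv (fun τ => v τ (φ.symm z)) t) y)
        * partialD j (v t ∘ φ.symm) y
      + (metricInv (g t) φ i j y * partialD i (v t ∘ φ.symm) y)
        * partialD j (fun z => deriv (fun τ => v τ (φ.symm z)) t) y
      = (if i = j then 2 * (partialD i (v t ∘ φ.symm) y
          * partialD i (fun z => deriv (fun τ => v τ (φ.symm z)) t) y) else 0)
        - deriv (fun τ => metricComp (g τ) φ i j y) t
          * partialD i (v t ∘ φ.symm) y * partialD j (v t ∘ φ.symm) y := by
    intro i j
    rw [hN.metricInv_eq]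
    split_ifs with hij
    · subst hij; ring
    · ring
  simp only [Pi.mul_apply, e, Finset.sum_sub_distrib, Finset.sum_ite_eq, Finset.mem_univ, if_true,
    Finset.mul_sum]

end JointRegularity

/-! ### The equation satisfied by the pressure -/

section Pressure

variable {p : ℝ} {u : ℝ → M → ℝ}

theorem SpaceTimeContMDiff.pressure (hu : SpaceTimeContMDiff n ∞ T u)
    (hpos : ∀ t ∈ Set.Icc 0 T, ∀ x, 0 < u t x) : SpaceTimeContMDiff n ∞ T (pressure p u) := by
  have h : ContDiffOn ℝ ∞ (fun r : ℝ => p * r ^ (p - 1) / (p - 1)) (Set.Ioi 0) := by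
    intro r hr
    have hr : r ≠ 0 := (Set.mem_Ioi.1 hr).ne'
    exact ((contDiffAt_const.mul (contDiffAt_id.rpow_const_of_ne hr)).div_const _).contDiffWithinAt
  exact h.contMDiffOn.comp hu fun q hq => hpos q.1 hq.1 q.2

theorem pressure_pos {M : Type*} {u : ℝ → M → ℝ} (hp : 1 < p) {t : ℝ} {x : M} (hu : 0 < u t x) : 0 < pressure p u t x := by
  unfold pressure
  have : 0 < p - 1 := by linarith
  positivity

theorem rpow_eq_of_pressure {M : Type*} {u : ℝ → M → ℝ} (hp : 1 < p) {t : ℝ} {x : M} :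
    (p - 1) * pressure p u t x / p = u t x ^ (p - 1) := by
  unfold pressure
  have : p - 1 ≠ 0 := by linarith
  have : p ≠ 0 := by linarith
  field_simp

theorem Sigma_pressure {M : Type*} {u : ℝ → M → ℝ} (hp : 1 < p) {N : ℝ → M → ℝ → ℝ} {t : ℝ} {x : M} (hu : 0 < u t x) :
    Sigma p N t x (pressure p u t x) = p * u t x ^ (p - 2) * N t x (u t x) := by
  have h1 : p - 1 ≠ 0 := by linarith
  rw [Sigma, rpow_eq_of_pressure hp, ← Real.rpow_mul hu.le, ← Real.rpow_mul hu.le,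
    mul_div_cancel₀ _ h1, mul_one_div_cancel h1, Real.rpow_one]

theorem partialD_rpow {U : EuclideanSpace ℝ (Fin n) → ℝ} {y : EuclideanSpace ℝ (Fin n)}
    (hU : DifferentiableAt ℝ U y) (h0 : 0 < U y) (r : ℝ) (i : Fin n) :
    partialD i (fun z => U z ^ r) y = r * U y ^ (r - 1) * partialD i U y := by
  have := (hU.hasFDerivAt.rpow_const (p := r) (Or.inl h0.ne')).fderiv
  simp [partialD, this]

/-- Since `∇v = p w^(p-2) ∇w`, one has `∇(w^p) = w ∇v` and `Δ_f w^p = w Δ_f v + ⟨∇w,∇v⟩`.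
Multiplication by `p w^(p-2)` turns `w` into `(p-1)v` and `∇w` into `∇v`. The computation is valid
in any chart. -/
theorem coordFLaplacian_rpow (hp : 1 < p) {g : Metric n M} {f w : M → ℝ}
    {y : EuclideanSpace ℝ (Fin n)} (hw : ContDiffAt ℝ 2 (w ∘ φ.symm) y) (h0 : 0 < w (φ.symm y)) :
    p * w (φ.symm y) ^ (p - 2) * coordFLaplacian g φ f (fun x => w x ^ p) y
      = (p - 1) * (p * w (φ.symm y) ^ (p - 1) / (p - 1))
          * coordFLaplacian g φ f (fun x => p * w x ^ (p - 1) / (p - 1)) y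
        + coordGradInner g φ ((fun x => p * w x ^ (p - 1) / (p - 1)) ∘ φ.symm)
            ((fun x => p * w x ^ (p - 1) / (p - 1)) ∘ φ.symm) y := by
  have hp1 : p - 1 ≠ 0 := by linarith
  set U : EuclideanSpace ℝ (Fin n) → ℝ := w ∘ φ.symm with hU
  set V : EuclideanSpace ℝ (Fin n) → ℝ := (fun x => p * w x ^ (p - 1) / (p - 1)) ∘ φ.symm with hV
  set W : EuclideanSpace ℝ (Fin n) → ℝ := (fun x => w x ^ p) ∘ φ.symm with hW
  have ev : ∀ᶠ z in nhds y, DifferentiableAt ℝ U z ∧ 0 < U z := by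
    filter_upwards [hw.eventually (by simp),
      hw.continuousAt.eventually (Ioi_mem_nhds h0)] with z h1 h2
    exact ⟨h1.differentiableAt (by norm_num), h2⟩
  have hVi : ∀ z, DifferentiableAt ℝ U z → 0 < U z → ∀ i,
      partialD i V z = p * U z ^ (p - 2) * partialD i U z := by
    intro z h1 h2 i
    have e : V = fun z => p / (p - 1) * U z ^ (p - 1) := by
      funext z
      simp only [hV, hU, Function.comp]
      ring
    rw [e, partialD_const_mul _ ((h1.hasFDerivAt.rpow_const (Or.inl h2.ne')).differentiableAt),
      partialD_rpow h1 h2, show p - 1 - 1 = p - 2 by ring]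
    field_simp
  have hWi : ∀ z, DifferentiableAt ℝ U z → 0 < U z → ∀ i,
      partialD i W z = U z * partialD i V z := by
    intro z h1 h2 i
    rw [hVi z h1 h2, show W = fun z => U z ^ p from rfl, partialD_rpow h1 h2,
      show p - 1 = (p - 2) + 1 by ring, Real.rpow_add_one h2.ne']
    ring
  have hVc : ContDiffAt ℝ 2 V y :=
    (contDiffAt_const.mul (hw.rpow_const_of_ne h0.ne')).div_const _
  obtain ⟨dU, pU⟩ := ev.self_of_nhds
  have hWij : ∀ i j, partialD i (partialD j W) y
      = partialD i U y * partialD j V y + U y * partialD i (partialD j V) y := by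
    intro i j
    have e : partialD j W =ᶠ[nhds y] fun z => U z * partialD j V z := by
      filter_upwards [ev] with z hz using hWi z hz.1 hz.2 j
    rw [partialD_congr e, partialD_mul dU (differentiableAt_partialD hVc j)]
  have hH : ∀ i j, hessian g φ (fun x => w x ^ p) i j y
      = U y * hessian g φ (fun x => p * w x ^ (p - 1) / (p - 1)) i j y
        + partialD i U y * partialD j V y := by
    intro i j
    unfold hessian
    rw [← hV, ← hW, hWij]
    have : ∀ k, christoffel g φ k i j y * partialD k W y
        = U y * (christoffel g φ k i j y * partialD k V y) := by
      intro k; rw [hWi y dU pU]; ring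
    simp only [this, ← Finset.mul_sum]
    ring
  have hpow : U y ^ (p - 1) = U y ^ (p - 2) * U y := by
    rw [show p - 1 = (p - 2) + 1 by ring, Real.rpow_add_one pU.ne']
  have e1 : (p - 1) * (p * w (φ.symm y) ^ (p - 1) / (p - 1)) = p * U y ^ (p - 2) * U y := by
    rw [show w (φ.symm y) = U y from rfl, hpow]
    field_simp
  rw [e1, show w (φ.symm y) = U y from rfl]
  unfold coordFLaplacian coordGradInner
  rw [← hV, ← hW]
  simp only [hH, hWi y dU pU, mul_sub, Finset.mul_sum]
  rw [← Finset.sum_sub_distrib, ← Finset.sum_sub_distrib, ← Finset.sum_add_distrib]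
  refine Finset.sum_congr rfl fun i _ => ?_
  rw [← Finset.sum_sub_distrib, ← Finset.sum_sub_distrib, ← Finset.sum_add_distrib]
  refine Finset.sum_congr rfl fun j _ => ?_
  rw [hVi y dU pU i]
  ring

/-- The equation for `u` multiplied by `p u^(p-2)`, which is the derivative of the pressure with
respect to `u`; the same factor turns the reaction into `Σ`. -/
theorem pressure_equation [IsManifold (𝓡 n) ∞ M] (hp : 1 < p) {g : ℝ → Metric n M}
    {f : ℝ → M → ℝ}
    (hf : SpaceTimeContMDiff n 2 T f) {N : ℝ → M → ℝ → ℝ} (hu : SpaceTimeContMDiff n ∞ T u)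
    (hpos : ∀ t ∈ Set.Icc 0 T, ∀ x, 0 < u t x) (hsol : IsSolution p T g f N u)
    (hφ : φ ∈ IsManifold.maximalAtlas (𝓡 n) ∞ M) {t : ℝ} (ht : t ∈ Set.Ioo 0 T)
    {y : EuclideanSpace ℝ (Fin n)} (hy : y ∈ φ.target) :
    deriv (fun τ => pressure p u τ (φ.symm y)) t
      = (p - 1) * pressure p u t (φ.symm y)
          * coordFLaplacian (g t) φ (f t) (pressure p u t) y
        + coordGradInner (g t) φ (pressure p u t ∘ φ.symm) (pressure p u t ∘ φ.symm) y
        + Sigma p N t (φ.symm y) (pressure p u t (φ.symm y)) := by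
  have ht' : t ∈ Set.Icc 0 T := ⟨ht.1.le, ht.2.le⟩
  have h0 := hpos t ht' (φ.symm y)
  have hp1 : p - 1 ≠ 0 := by linarith
  have hUc := hu.contDiffOn le_rfl hφ
  have hU : ContDiffAt ℝ 2 (u t ∘ φ.symm) y :=
    (contDiffAt_slice φ.open_target hUc ht' hy).of_le (by norm_cast)
  have hut : HasDerivAt (fun τ => u τ (φ.symm y)) (deriv (fun τ => u τ (φ.symm y)) t) t := by
    have h1 := contDiffAt_interior φ.open_target hUc ht hy
    have h2 : ContDiffAt ℝ ∞ (fun τ => u τ (φ.symm y)) t :=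
      ContDiffAt.comp (f := fun τ : ℝ => (τ, y)) (g := fun q => u q.1 (φ.symm q.2)) t h1
        (contDiffAt_id.prodMk contDiffAt_const)
    exact (h2.differentiableAt (by simp)).hasDerivAt
  have hvt := (((hut.rpow_const (p := p - 1) (Or.inl h0.ne')).const_mul p).div_const (p - 1)).deriv
  have hs := hsol φ hφ (φ.symm y) (φ.map_target hy) t ⟨ht.1, ht.2.le⟩
  rw [derivWithin_of_mem_nhds (Icc_mem_nhds ht.1 ht.2)] at hs
  have hfm := hf.mdifferentiableAt (by norm_num) ht' (φ.symm y)
  have hum : MDifferentiableAt (𝓡 n) 𝓘(ℝ, ℝ) (fun x => u t x ^ p) (φ.symm y) := by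
    have h1 := hu.mdifferentiableAt (by simp) ht' (φ.symm y)
    have h2 : DifferentiableAt ℝ (fun r : ℝ => r ^ p) (u t (φ.symm y)) :=
      (Real.hasDerivAt_rpow_const (Or.inl h0.ne')).differentiableAt
    exact h2.mdifferentiableAt.comp _ h1
  have hL : fLaplacian (g t) (f t) φ (fun x => u t x ^ p) (φ.symm y)
      = coordFLaplacian (g t) φ (f t) (fun x => u t x ^ p) y := by
    unfold fLaplacian laplacian coordFLaplacian
    rw [φ.right_inv hy, gradInner_eq_coordGradInner hφ hy hfm hum]
  rw [hL] at hs
  have hc := coordFLaplacian_rpow (g := g t) (f := f t) hp hU h0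
  change deriv (fun τ => p * u τ (φ.symm y) ^ (p - 1) / (p - 1)) t = _
  rw [hvt, Sigma_pressure hp h0, ← hs, show p - 1 - 1 = p - 2 by ring]
  have e : p * (deriv (fun τ => u τ (φ.symm y)) t * (p - 1) * u t (φ.symm y) ^ (p - 2)) / (p - 1)
      = p * u t (φ.symm y) ^ (p - 2) * deriv (fun τ => u τ (φ.symm y)) t := by
    field_simp
  rw [e]
  change _ = (p - 1) * (p * u t (φ.symm y) ^ (p - 1) / (p - 1))
      * coordFLaplacian (g t) φ (f t) (fun x => p * u t x ^ (p - 1) / (p - 1)) y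
    + coordGradInner (g t) φ ((fun x => p * u t x ^ (p - 1) / (p - 1)) ∘ φ.symm)
            ((fun x => p * u t x ^ (p - 1) / (p - 1)) ∘ φ.symm) y + _
  rw [← hc]
  ring

end Pressure

/-! ### Derivatives of the reaction term -/

section Reaction

variable {p : ℝ} {N : ℝ → M → ℝ → ℝ} {t : ℝ}

theorem contMDiffOn_Sigma (hp : 1 < p) (hN : ContMDiffOn ((𝓡 n).prod 𝓘(ℝ, ℝ)) 𝓘(ℝ, ℝ) 1
    (fun q : M × ℝ => N t q.1 q.2) (Set.univ ×ˢ Set.Ioi 0)) :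
    ContMDiffOn ((𝓡 n).prod 𝓘(ℝ, ℝ)) 𝓘(ℝ, ℝ) 1
      (fun q : M × ℝ => Sigma p N t q.1 q.2) (Set.univ ×ˢ Set.Ioi 0) := by
  have hpos : ∀ r : ℝ, 0 < r → 0 < (p - 1) * r / p := fun r hr =>
    div_pos (mul_pos (by linarith) hr) (by linarith)
  have hpow : ∀ e : ℝ, ContDiffOn ℝ 1 (fun r : ℝ => ((p - 1) * r / p) ^ e) (Set.Ioi 0) := by
    intro e r hr
    have hr : r ∈ Set.Ioi (0 : ℝ) := hr
    exact (((contDiffAt_const.mul contDiffAt_id).div_const _).rpow_const_of_ne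
      (hpos r hr).ne').contDiffWithinAt
  have hsnd : ContMDiffOn ((𝓡 n).prod 𝓘(ℝ, ℝ)) 𝓘(ℝ, ℝ) 1 (fun q : M × ℝ => q.2)
      (Set.univ ×ˢ Set.Ioi 0) := contMDiff_snd.contMDiffOn
  have hpow' : ∀ e : ℝ, ContMDiffOn ((𝓡 n).prod 𝓘(ℝ, ℝ)) 𝓘(ℝ, ℝ) 1
      (fun q : M × ℝ => ((p - 1) * q.2 / p) ^ e) (Set.univ ×ˢ Set.Ioi 0) := fun e =>
    (hpow e).contMDiffOn.comp hsnd fun q hq => hq.2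
  have hNc : ContMDiffOn ((𝓡 n).prod 𝓘(ℝ, ℝ)) 𝓘(ℝ, ℝ) 1
      (fun q : M × ℝ => N t q.1 (((p - 1) * q.2 / p) ^ (1 / (p - 1)))) (Set.univ ×ˢ Set.Ioi 0) :=
    hN.comp (contMDiff_fst.contMDiffOn.prodMk (hpow' _)) fun q hq =>
      ⟨Set.mem_univ _, Real.rpow_pos_of_pos (hpos _ hq.2) _⟩
  exact (contMDiffOn_const.mul (hpow' _)).mul hNc

theorem mdifferentiableAt_Sigma (hp : 1 < p) (hN : ContMDiffOn ((𝓡 n).prod 𝓘(ℝ, ℝ)) 𝓘(ℝ, ℝ) 1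
    (fun q : M × ℝ => N t q.1 q.2) (Set.univ ×ˢ Set.Ioi 0)) {r : ℝ} (hr : 0 < r) (x : M) :
    MDifferentiableAt (𝓡 n) 𝓘(ℝ, ℝ) (fun x => Sigma p N t x r) x := by
  have h1 : ContMDiff (𝓡 n) ((𝓡 n).prod 𝓘(ℝ, ℝ)) 1 (fun x : M => (x, r)) :=
    contMDiff_id.prodMk contMDiff_const
  have h2 : ContMDiffOn (𝓡 n) 𝓘(ℝ, ℝ) 1 (fun x => Sigma p N t x r) Set.univ :=
    ContMDiffOn.comp (I' := (𝓡 n).prod 𝓘(ℝ, ℝ)) (g := fun q : M × ℝ => Sigma p N t q.1 q.2)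
      (f := fun x : M => (x, r)) (t := (Set.univ ×ˢ Set.Ioi 0 : Set (M × ℝ)))
      (contMDiffOn_Sigma hp hN)
      h1.contMDiffOn
      fun x _ => ⟨Set.mem_univ _, hr⟩
  exact (contMDiffOn_univ.1 h2).contMDiffAt.mdifferentiableAt (by norm_num)

theorem differentiableAt_Sigma_chart (hp : 1 < p)
    (hN : ContMDiffOn ((𝓡 n).prod 𝓘(ℝ, ℝ)) 𝓘(ℝ, ℝ) 1
    (fun q : M × ℝ => N t q.1 q.2) (Set.univ ×ˢ Set.Ioi 0))
    (hφ : φ ∈ IsManifold.maximalAtlas (𝓡 n) ∞ M) {y : EuclideanSpace ℝ (Fin n)}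
    (hy : y ∈ φ.target) {r : ℝ} (hr : 0 < r) :
    DifferentiableAt ℝ (fun q : EuclideanSpace ℝ (Fin n) × ℝ => Sigma p N t (φ.symm q.1) q.2)
      (y, r) := by
  have h : ContMDiffOn 𝓘(ℝ, EuclideanSpace ℝ (Fin n) × ℝ) ((𝓡 n).prod 𝓘(ℝ, ℝ)) 1
      (fun q : EuclideanSpace ℝ (Fin n) × ℝ => (φ.symm q.1, q.2))
      (φ.target ×ˢ Set.Ioi 0) := by
    refine ContMDiffOn.prodMk ?_ contDiff_snd.contMDiff.contMDiffOn
    exact ((contMDiffOn_symm_of_mem_maximalAtlas hφ).of_le (by norm_cast)).comp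
      contDiff_fst.contMDiff.contMDiffOn fun q hq => hq.1
  have h2 := ContMDiffOn.comp (contMDiffOn_Sigma hp hN) h fun q hq => ⟨Set.mem_univ _, hq.2⟩
  exact (h2.contDiffOn.contDiffAt ((φ.open_target.prod isOpen_Ioi).mem_nhds
    (show (y, r) ∈ φ.target ×ˢ Set.Ioi (0 : ℝ) from ⟨hy, hr⟩))
    ).differentiableAt (by norm_num)

/-- The chain rule separates the gradient with the value frozen from the derivative in the value;
the hypotheses on the reaction treat these two parts separately. -/
theorem partialD_Sigma (hp : 1 < p)
    (hN : ContMDiffOn ((𝓡 n).prod 𝓘(ℝ, ℝ)) 𝓘(ℝ, ℝ) 1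
    (fun q : M × ℝ => N t q.1 q.2) (Set.univ ×ˢ Set.Ioi 0))
    (hφ : φ ∈ IsManifold.maximalAtlas (𝓡 n) ∞ M) {y : EuclideanSpace ℝ (Fin n)}
    (hy : y ∈ φ.target) {V : EuclideanSpace ℝ (Fin n) → ℝ} (hV : DifferentiableAt ℝ V y)
    (hr : 0 < V y) (i : Fin n) :
    DifferentiableAt ℝ (fun z => Sigma p N t (φ.symm z) (V z)) y ∧
    partialD i (fun z => Sigma p N t (φ.symm z) (V z)) y
      = partialD i (fun z => Sigma p N t (φ.symm z) (V y)) y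
        + deriv (Sigma p N t (φ.symm y)) (V y) * partialD i V y := by
  have h := (differentiableAt_Sigma_chart hp hN hφ hy hr).hasFDerivAt
  have h1 := h.comp y ((hasFDerivAt_id y).prodMk hV.hasFDerivAt)
  have h2 := h.comp y (hasFDerivAt_prodMk_left (𝕜 := ℝ) y (V y))
  have h3 := h.comp_hasDerivAt (V y) ((hasDerivAt_const (V y) y).prodMk (hasDerivAt_id (V y)))
  refine ⟨h1.differentiableAt, ?_⟩
  have e1 := h1.fderiv
  have e2 := h2.fderiv
  have e3 := h3.deriv
  simp only [Function.comp_def, id] at e1 e2 e3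
  unfold partialD
  rw [e1, e2, show deriv (Sigma p N t (φ.symm y)) (V y) = _ from e3]
  set D := fderiv ℝ (fun q : EuclideanSpace ℝ (Fin n) × ℝ => Sigma p N t (φ.symm q.1) q.2) (y, V y)
  have e4 : ((EuclideanSpace.single i 1, fderiv ℝ V y (EuclideanSpace.single i 1)) :
      EuclideanSpace ℝ (Fin n) × ℝ)
      = (EuclideanSpace.single i 1, 0) + fderiv ℝ V y (EuclideanSpace.single i 1) • (0, 1) := by
    ext <;> simp
  simp only [ContinuousLinearMap.comp_apply, ContinuousLinearMap.prod_apply,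
    ContinuousLinearMap.id_apply, ContinuousLinearMap.inl_apply]
  rw [e4, map_add, map_smul, smul_eq_mul, mul_comm]

end Reaction

end Coordinates

section Evolution

variable {n : ℕ} {M : Type*} [TopologicalSpace M] [ChartedSpace (EuclideanSpace ℝ (Fin n)) M]
  {φ : OpenPartialHomeomorph M (EuclideanSpace ℝ (Fin n))} {T : ℝ}

/-! ### Evolution of `|∇v|²` -/

/-- The spatial gradient of the pressure equation is paired with `∇v`, and the Bochner formula
rewrites `⟨∇v, ∇Δ_f v⟩`. The time derivative of the metric and the curvature together form the super
flow tensor evaluated on `∇v`, which costs only `k|∇v|²`. As `Ric_f^m` contains `-∇f⊗∇f/(m-n)`, a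
good term in `⟨∇f,∇v⟩²` is left beside the Hessian. -/
theorem deriv_coordGradInner_le [IsManifold (𝓡 n) ∞ M] {p m k : ℝ} (hT : 0 < T) (hp : 1 < p)
    {g : ℝ → Metric n M} (hg : MetricC2 T g)
    {f : ℝ → M → ℝ} (hf : SpaceTimeContMDiff n 2 T f) {N : ℝ → M → ℝ → ℝ}
    (hN : ∀ t ∈ Set.Ioc 0 T, ContMDiffOn ((𝓡 n).prod 𝓘(ℝ, ℝ)) 𝓘(ℝ, ℝ) 1
      (fun q : M × ℝ => N t q.1 q.2) (Set.univ ×ˢ Set.Ioi 0))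
    {u : ℝ → M → ℝ} (hu : SpaceTimeContMDiff n ∞ T u)
    (hpos : ∀ t ∈ Set.Icc 0 T, ∀ x, 0 < u t x) (hsol : IsSolution p T g f N u)
    {v : ℝ → M → ℝ} (hv : v = pressure p u) (hflow : SuperFlow p m k T g f v)
    (hφ : φ ∈ IsManifold.maximalAtlas (𝓡 n) ∞ M) {t : ℝ} (ht : t ∈ Set.Ioo 0 T)
    {y : EuclideanSpace ℝ (Fin n)} (hy : y ∈ φ.target) (hNy : NormalAt (g t) φ y)
    {W F P : EuclideanSpace ℝ (Fin n) → ℝ} (hW : W = v t ∘ φ.symm) (hF : F = f t ∘ φ.symm)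
    (hP : P = coordGradInner (g t) φ W W) {Pt : ℝ}
    (hPt : HasDerivAt (fun τ => coordGradInner (g τ) φ (v τ ∘ φ.symm) (v τ ∘ φ.symm) y) Pt t) :
    Pt / 2 ≤ k * P y + (p - 1) * W y *
        ((∑ l, partialD l (partialD l P) y - ∑ l, partialD l F y * partialD l P y) / 2)
      + (p - 1) * P y * coordFLaplacian (g t) φ (f t) (v t) y
      - (p - 1) * W y * (∑ l, ∑ i, partialD l (partialD i W) y ^ 2
          + (∑ i, partialD i F y * partialD i W y) ^ 2 / (m - n))
      + ∑ l, partialD l W y * partialD l P y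
      + ∑ l, partialD l W y * partialD l (fun z => Sigma p N t (φ.symm z) (W y)) y
      + deriv (Sigma p N t (φ.symm y)) (W y) * P y := by
  have ht' : t ∈ Set.Icc 0 T := ⟨ht.1.le, ht.2.le⟩
  have htoc : t ∈ Set.Ioc 0 T := ⟨ht.1, ht.2.le⟩
  have hvs : SpaceTimeContMDiff n ∞ T v := hv ▸ hu.pressure hpos
  have hWpos : 0 < W y := by rw [hW, hv]; exact pressure_pos hp (hpos t ht' _)
  have hW3 : ContDiffAt ℝ 3 W y := by
    rw [hW]
    exact (contDiffAt_slice φ.open_target (hvs.contDiffOn le_rfl hφ) ht' hy).of_le (by norm_cast)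
  have hW2 : ContDiffAt ℝ 2 W y := hW3.of_le (by norm_num)
  have dW : DifferentiableAt ℝ W y := hW2.differentiableAt (by norm_num)
  have hF2 : ContDiffAt ℝ 2 F y := by
    rw [hF]
    exact contDiffAt_slice φ.open_target (hf.contDiffOn (by norm_cast) hφ) ht' hy
  have hPy : P y = ∑ i, partialD i W y ^ 2 := by
    rw [hP, hNy.coordGradInner_eq]
    exact Finset.sum_congr rfl fun i _ => by ring
  have dP : DifferentiableAt ℝ P y := hP ▸ hNy.differentiableAt_coordGradInner hW2 hW2
  have dL : DifferentiableAt ℝ (coordFLaplacian (g t) φ (f t) (v t)) y :=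
    hNy.differentiableAt_coordFLaplacian (hW ▸ hW3) (hF ▸ hF2)
  have hS := fun i => partialD_Sigma (i := i) hp (hN t htoc) hφ hy dW hWpos
  have hVt : ∀ i, partialD i (fun z => deriv (fun τ => v τ (φ.symm z)) t) y
      = (p - 1) * (partialD i W y * coordFLaplacian (g t) φ (f t) (v t) y
          + W y * partialD i (coordFLaplacian (g t) φ (f t) (v t)) y) + partialD i P y
        + (partialD i (fun z => Sigma p N t (φ.symm z) (W y)) y
          + deriv (Sigma p N t (φ.symm y)) (W y) * partialD i W y) := by
    intro i
    have e : (fun z => deriv (fun τ => v τ (φ.symm z)) t) =ᶠ[nhds y] fun z =>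
        (p - 1) * (W z * coordFLaplacian (g t) φ (f t) (v t) z) + P z
          + Sigma p N t (φ.symm z) (W z) := by
      filter_upwards [φ.open_target.mem_nhds hy] with z hz
      have := pressure_equation hp hf hu hpos hsol hφ ht hz
      rw [← hv] at this
      rw [this, hP, hW]
      simp only [Function.comp]
      ring
    rw [partialD_congr e, partialD_add (((dW.fun_mul dL).const_mul _).fun_add dP) (hS i).1,
      partialD_add ((dW.fun_mul dL).const_mul _) dP, partialD_const_mul _ (dW.fun_mul dL),
      partialD_mul dW dL, (hS i).2]
  have hPt' := hPt.unique (hasDerivAt_coordGradInner hT hg hvs hφ ht hy hNy)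
  rw [← hW] at hPt'
  have hsum : ∑ i, partialD i W y * partialD i (fun z => deriv (fun τ => v τ (φ.symm z)) t) y
      = (p - 1) * P y * coordFLaplacian (g t) φ (f t) (v t) y
        + (p - 1) * W y * ∑ l, partialD l W y
            * partialD l (coordFLaplacian (g t) φ (f t) (v t)) y
        + ∑ l, partialD l W y * partialD l P y
        + ∑ l, partialD l W y * partialD l (fun z => Sigma p N t (φ.symm z) (W y)) y
        + deriv (Sigma p N t (φ.symm y)) (W y) * P y := by
    rw [hPy]
    simp only [hVt, Finset.mul_sum, Finset.sum_mul, ← Finset.sum_add_distrib]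
    exact Finset.sum_congr rfl fun i _ => by ring
  have hB := hNy.bochner (w := v t) (f := f t) (hW ▸ hW3) (hF ▸ hF2)
  rw [← hW, ← hF, ← hP] at hB
  have hfl := hflow φ hφ (φ.symm y) (φ.map_target hy) t htoc fun i => partialD i W y
  rw [φ.right_inv hy] at hfl
  have hfl1 : ∑ i, ∑ j, metricComp (g t) φ i j y * partialD i W y * partialD j W y = P y := by
    rw [hPy]
    simp only [hNy.comp_eq, ite_mul, one_mul, zero_mul, Finset.sum_ite_eq, Finset.mem_univ,
      if_true]
    exact Finset.sum_congr rfl fun i _ => by ring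
  have hfl2 : ∑ i, ∑ j, (1 / 2 * derivWithin (fun τ => metricComp (g τ) φ i j y) (Set.Icc 0 T) t
        + (p - 1) * v t (φ.symm y) * bakryEmery m (g t) (f t) φ i j y)
          * partialD i W y * partialD j W y
      = 1 / 2 * ∑ i, ∑ j, deriv (fun τ => metricComp (g τ) φ i j y) t
          * partialD i W y * partialD j W y
        + (p - 1) * W y * (∑ i, ∑ j, (ricci (g t) φ i j y + hessian (g t) φ (f t) i j y)
          * partialD i W y * partialD j W y
          - (∑ i, partialD i F y * partialD i W y) ^ 2 / (m - n)) := by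
    rw [sq, Finset.sum_mul_sum]
    simp only [Finset.mul_sum, Finset.sum_div, mul_sub, ← Finset.sum_add_distrib,
      ← Finset.sum_sub_distrib]
    refine Finset.sum_congr rfl fun i _ => Finset.sum_congr rfl fun j _ => ?_
    rw [derivWithin_of_mem_nhds (Icc_mem_nhds ht.1 ht.2), bakryEmery, ← hF,
      show v t (φ.symm y) = W y by rw [hW]; rfl]
    ring
  rw [hfl1, hfl2] at hfl
  rw [hPt', show ∀ a b : ℝ, (2 * a - b) / 2 = a - 1 / 2 * b by intros; ring, hsum, hB]
  linarith

end Evolution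

section Profile

variable {n : ℕ} {M : Type*} [TopologicalSpace M] [ChartedSpace (EuclideanSpace ℝ (Fin n)) M]
  {T : ℝ}

/-! ### The quantity to which the maximum principle is applied -/

theorem gradInner_self_nonneg (g : Metric n M) (w : M → ℝ) (x : M) : 0 ≤ gradInner g w w x := by
  unfold gradInner
  rcases eq_or_ne (gradient g w x) 0 with h | h
  · simp [h]
  · exact (g.pos x _ h).le

theorem weightedGrad_eq (p s : ℝ) (g : ℝ → Metric n M) (v : ℝ → M → ℝ) (t : ℝ) (x : M) :
    weightedGrad p s g v t x
      = v t x ^ (s / (2 * (s - 1) * (p - 1))) * gradInner (g t) (v t) (v t) x ^ (s / 2) := by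
  unfold weightedGrad gradNorm
  rw [Real.sqrt_eq_rpow, ← Real.rpow_mul (gradInner_self_nonneg _ _ _)]
  congr 2
  ring

/-- `e^(-κ t) v^(s/(2(s-1)(p-1))) |∇v|^s + Γ(v)`. -/
def profile (p s κ : ℝ) (Γ : ℝ → ℝ) (g : ℝ → Metric n M) (v : ℝ → M → ℝ) (t : ℝ) (x : M) : ℝ :=
  Real.exp (-κ * t) * weightedGrad p s g v t x + Γ (v t x)

theorem mul_sub_one_le {p s m : ℝ} (hs : 2 ≤ s) (hm : 2 ≤ m) (hp : 1 < p)
    (hp' : p ≤ 1 + 1 / Real.sqrt ((s - 1) * (m - 1))) :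
    (p - 1) ^ 2 * ((s - 1) * (m - 1)) ≤ 1 := by
  have h : 0 < (s - 1) * (m - 1) := mul_pos (by linarith) (by linarith)
  have hsq := Real.sqrt_pos.2 h
  have h1 : (p - 1) * Real.sqrt ((s - 1) * (m - 1)) ≤ 1 := by
    rw [← le_div_iff₀ hsq]
    linarith
  calc (p - 1) ^ 2 * ((s - 1) * (m - 1))
      = ((p - 1) * Real.sqrt ((s - 1) * (m - 1))) ^ 2 := by rw [mul_pow, Real.sq_sqrt h.le]
    _ ≤ 1 := pow_le_one₀ (mul_nonneg (by linarith) hsq.le) h1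

/-- At a spatial maximum the profile does not increase in time. -/
theorem exists_hasDerivAt_profile_nonpos [IsManifold (𝓡 n) ∞ M] (hn : 2 ≤ n)
    {p s m k a : ℝ} (hT : 0 < T) (hs : 2 ≤ s) (hm : (n : ℝ) ≤ m)
    (hp : 1 < p) (hp' : p ≤ 1 + 1 / Real.sqrt ((s - 1) * (m - 1)))
    {g : ℝ → Metric n M} (hg : MetricC2 T g)
    {f : ℝ → M → ℝ} (hf : SpaceTimeContMDiff n 2 T f)
    (hfm : m = n → ∀ t ∈ Set.Icc 0 T, ∀ x y : M, f t x = f t y)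
    {N : ℝ → M → ℝ → ℝ}
    (hN : ∀ t ∈ Set.Ioc 0 T, ContMDiffOn ((𝓡 n).prod 𝓘(ℝ, ℝ)) 𝓘(ℝ, ℝ) 1
      (fun q : M × ℝ => N t q.1 q.2) (Set.univ ×ˢ Set.Ioi 0))
    {u : ℝ → M → ℝ} (hu : SpaceTimeContMDiff n ∞ T u)
    (hpos : ∀ t ∈ Set.Icc 0 T, ∀ x, 0 < u t x) (hsol : IsSolution p T g f N u)
    {v : ℝ → M → ℝ} (hv : v = pressure p u) (hflow : SuperFlow p m k T g f v)
    {Γ : ℝ → ℝ} (hΓ : ContDiffOn ℝ 2 Γ (Set.Ioi 0)) {t : ℝ} (ht : t ∈ Set.Ioo 0 T) {x : M}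
    (h₁ : deriv Γ (v t x) * Sigma p N t x (v t x) ≤ 0)
    (h₂ : 0 ≤ deriv Γ (v t x) + v t x * deriv (deriv Γ) (v t x))
    (h₃ : gradInner (g t) (v t) (fun y => Sigma p N t y (v t x)) x ≤ 0)
    (h₄ : deriv (Sigma p N t x) (v t x)
      + Sigma p N t x (v t x) / (2 * (s - 1) * (p - 1) * v t x) ≤ a)
    (hmax : ∀ z, profile p s (s * (k + a)) Γ g v t z ≤ profile p s (s * (k + a)) Γ g v t x) :
    ∃ d ≤ 0, HasDerivAt (fun τ => profile p s (s * (k + a)) Γ g v τ x) d t := by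
  have ht' : t ∈ Set.Icc 0 T := ⟨ht.1.le, ht.2.le⟩
  have htoc : t ∈ Set.Ioc 0 T := ⟨ht.1, ht.2.le⟩
  obtain ⟨φ, hφ, hxφ, hNy⟩ := exists_normalAt (g t)
    (fun φ hφ y hy i j => contDiffAt_metricComp hg ht' hφ hy i j) x
  obtain ⟨y, hy, rfl⟩ : ∃ y ∈ φ.target, φ.symm y = x := ⟨φ x, φ.map_source hxφ, φ.left_inv hxφ⟩
  rw [φ.right_inv hy] at hNy
  have hvs : SpaceTimeContMDiff n ∞ T v := hv ▸ hu.pressure hpos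
  set κ := s * (k + a) with hκ
  set β := s / (2 * (s - 1) * (p - 1)) with hβ
  set σ := s / 2 with hσ
  set W : EuclideanSpace ℝ (Fin n) → ℝ := v t ∘ φ.symm with hW
  set F : EuclideanSpace ℝ (Fin n) → ℝ := f t ∘ φ.symm with hF
  set P : EuclideanSpace ℝ (Fin n) → ℝ := coordGradInner (g t) φ W W with hP
  have hWy : v t (φ.symm y) = W y := rfl
  rw [hWy] at h₁ h₂ h₃ h₄
  have hWpos : 0 < W y := by rw [← hWy, hv]; exact pressure_pos hp (hpos t ht' _)
  have hgrad : ∀ τ ∈ Set.Icc 0 T, ∀ z ∈ φ.target, gradInner (g τ) (v τ) (v τ) (φ.symm z)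
      = coordGradInner (g τ) φ (v τ ∘ φ.symm) (v τ ∘ φ.symm) z := fun τ hτ z hz =>
    gradInner_eq_coordGradInner hφ hz (hvs.mdifferentiableAt (by simp) hτ _)
      (hvs.mdifferentiableAt (by simp) hτ _)
  have hprof : ∀ τ ∈ Set.Icc 0 T, ∀ z ∈ φ.target, profile p s κ Γ g v τ (φ.symm z)
      = Real.exp (-κ * τ) * (v τ (φ.symm z) ^ β
        * coordGradInner (g τ) φ (v τ ∘ φ.symm) (v τ ∘ φ.symm) z ^ σ) + Γ (v τ (φ.symm z)) := by
    intro τ hτ z hz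
    rw [profile, weightedGrad_eq, hgrad τ hτ z hz]
  have hW3 : ContDiffAt ℝ 3 W y :=
    (contDiffAt_slice φ.open_target (hvs.contDiffOn le_rfl hφ) ht' hy).of_le (by norm_cast)
  have hP2 : ContDiffAt ℝ 2 P y :=
    contDiffAt_slice φ.open_target (contDiffOn_coordGradInner hT hg hvs hφ) ht' hy
  have hPy : P y = ∑ i, partialD i W y ^ 2 := by
    rw [hP, hNy.coordGradInner_eq]
    exact Finset.sum_congr rfl fun i _ => by ring
  have hPnn : ∀ z ∈ φ.target, 0 ≤ P z := fun z hz => by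
    rw [hP, hW, ← hgrad t ht' z hz]
    exact gradInner_self_nonneg _ _ _
  -- Derivatives along coordinate lines.
  have hline : ∀ {K : EuclideanSpace ℝ (Fin n) → ℝ}, ContDiffAt ℝ 2 K y → ∀ l : Fin n,
      (∀ᶠ τ in nhds (0 : ℝ), HasDerivAt (fun τ : ℝ => K (y + τ • EuclideanSpace.single l 1))
        (partialD l K (y + τ • EuclideanSpace.single l 1)) τ) ∧
      HasDerivAt (fun τ : ℝ => partialD l K (y + τ • EuclideanSpace.single l 1))
        (partialD l (partialD l K) y) 0 := by
    intro K hK l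
    have hc : Filter.Tendsto (fun τ : ℝ => y + τ • EuclideanSpace.single l (1 : ℝ)) (nhds 0)
        (nhds y) := by
      have : Continuous fun τ : ℝ => y + τ • EuclideanSpace.single l (1 : ℝ) := by fun_prop
      simpa using this.tendsto 0
    refine ⟨?_, hasDerivAt_line (differentiableAt_partialD hK l) _ (by simp)⟩
    filter_upwards [hc.eventually (hK.eventually (by simp))] with τ hτ
    exact hasDerivAt_line (hτ.differentiableAt (by norm_num)) _ rfl
  set E := Real.exp (-κ * t) with hE
  have hEpos : 0 < E := Real.exp_pos _
  have hlocmax : ∀ l : Fin n, IsLocalMax (fun τ : ℝ =>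
      E * (W (y + τ • EuclideanSpace.single l 1) ^ β * P (y + τ • EuclideanSpace.single l 1) ^ σ)
        + Γ (W (y + τ • EuclideanSpace.single l 1))) 0 := by
    intro l
    have hc : Filter.Tendsto (fun τ : ℝ => y + τ • EuclideanSpace.single l (1 : ℝ)) (nhds 0)
        (nhds y) := by
      have : Continuous fun τ : ℝ => y + τ • EuclideanSpace.single l (1 : ℝ) := by fun_prop
      simpa using this.tendsto 0
    filter_upwards [hc.eventually (φ.open_target.mem_nhds hy)] with τ hτ
    have h5 := hmax (φ.symm (y + τ • EuclideanSpace.single l 1))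
    rw [hprof t ht' _ hτ, hprof t ht' _ hy] at h5
    simp only [zero_smul, add_zero]
    exact h5
  -- Derivatives in time.
  have hVtd : HasDerivAt (fun τ => v τ (φ.symm y)) (deriv (fun τ => v τ (φ.symm y)) t) t := by
    have h5 := contDiffAt_interior φ.open_target (hvs.contDiffOn le_rfl hφ) ht hy
    have h6 : ContDiffAt ℝ ∞ (fun τ => v τ (φ.symm y)) t :=
      ContDiffAt.comp (f := fun τ : ℝ => (τ, y)) (g := fun q => v q.1 (φ.symm q.2)) t h5
        (contDiffAt_id.prodMk contDiffAt_const)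
    exact (h6.differentiableAt (by simp)).hasDerivAt
  have hVt := pressure_equation hp hf hu hpos hsol hφ ht hy
  rw [← hv, ← hW, ← hP, hWy] at hVt
  set Vt := deriv (fun τ => v τ (φ.symm y)) t with hVtdef
  obtain ⟨Pt, hPt⟩ : ∃ Pt, HasDerivAt
      (fun τ => coordGradInner (g τ) φ (v τ ∘ φ.symm) (v τ ∘ φ.symm) y) Pt t :=
    ⟨_, hasDerivAt_coordGradInner hT hg hvs hφ ht hy hNy⟩
  have hEd : HasDerivAt (fun τ => Real.exp (-κ * τ)) (-κ * E) t := by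
    have := ((hasDerivAt_id t).const_mul (-κ)).exp
    refine this.congr_deriv ?_
    simp only [hE, id]
    ring
  have hΓd := (hasDerivAt_of_contDiffOn_Ioi hΓ hWpos).1
  -- An exponent of at least `1` makes `P^σ` differentiable in time even where `P` vanishes, so one
  -- formula serves both cases below.
  have hσ1 : 1 ≤ σ := by rw [hσ]; linarith
  have hder : HasDerivAt (fun τ => profile p s κ Γ g v τ (φ.symm y))
      (-κ * E * (W y ^ β * P y ^ σ)
        + E * (Vt * β * W y ^ (β - 1) * P y ^ σ + W y ^ β * (Pt * σ * P y ^ (σ - 1)))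
        + deriv Γ (W y) * Vt) t := by
    have h5 := (hEd.mul ((hVtd.rpow_const (p := β) (Or.inl hWpos.ne')).mul
      (hPt.rpow_const (p := σ) (Or.inr hσ1)))).add (hΓd.comp t hVtd)
    refine h5.congr_of_eventuallyEq ?_
    filter_upwards [Icc_mem_nhds ht.1 ht.2] with τ hτ using hprof τ hτ y hy
  refine ⟨_, ?_, hder⟩
  have hL := hNy.coordFLaplacian_eq (f := f t) (w := v t)
  rw [← hF, ← hW] at hL
  set L := coordFLaplacian (g t) φ (f t) (v t) y with hLdef
  rcases (hPnn y hy).eq_or_lt with hP0 | hPpos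
  · -- The gradient vanishes.
    have hWi : ∀ i, partialD i W y = 0 := by
      intro i
      have h5 := (Finset.sum_eq_zero_iff_of_nonneg fun i _ => sq_nonneg (partialD i W y)).1
        (hPy.symm.trans hP0.symm) i (Finset.mem_univ i)
      exact pow_eq_zero_iff (two_ne_zero) |>.1 h5
    -- The squared gradient is nonnegative at all times and zero now, so it is minimal in time.
    have hPt0 : Pt = 0 := by
      refine IsLocalMin.hasDerivAt_eq_zero (a := t) ?_ hPt
      filter_upwards [Icc_mem_nhds ht.1 ht.2] with τ hτ
      change P y ≤ _
      rw [← hP0, ← hgrad τ hτ y hy]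
      exact gradInner_self_nonneg _ _ _
    have hsec : ∀ l, deriv Γ (W y) * partialD l (partialD l W) y ≤ 0 := by
      intro l
      obtain ⟨l1, l2⟩ := hline (hW3.of_le (by norm_num)) l
      -- The weighted gradient term is nonnegative and vanishes at the point, so `Γ(v)` alone is
      -- maximal there. The derivative test is applied with weight `0` and dummy factor `1`, because
      -- real powers of `P` cannot be differentiated twice at its zero in general.
      have h5 : IsLocalMax (fun τ : ℝ => 0 * (W (y + τ • EuclideanSpace.single l 1) ^ (1 : ℝ)
          * (fun _ : ℝ => (1 : ℝ)) τ ^ (1 : ℝ)) + Γ (W (y + τ • EuclideanSpace.single l 1))) 0 := by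
        have hc : Filter.Tendsto (fun τ : ℝ => y + τ • EuclideanSpace.single l (1 : ℝ)) (nhds 0)
            (nhds y) := by
          have : Continuous fun τ : ℝ => y + τ • EuclideanSpace.single l (1 : ℝ) := by fun_prop
          simpa using this.tendsto 0
        filter_upwards [hlocmax l, hc.eventually (φ.open_target.mem_nhds hy),
          hc.eventually (hW3.continuousAt.eventually (Ioi_mem_nhds hWpos))] with τ h6 h7 h8
        have h8 : 0 < W (y + τ • EuclideanSpace.single l 1) := h8
        have h9 : 0 ≤ E * (W (y + τ • EuclideanSpace.single l 1) ^ β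
            * P (y + τ • EuclideanSpace.single l 1) ^ σ) :=
          mul_nonneg hEpos.le (mul_nonneg (Real.rpow_nonneg h8.le _)
            (Real.rpow_nonneg (hPnn _ h7) _))
        simp only [zero_smul, add_zero, ← hP0, Real.zero_rpow (by linarith : σ ≠ 0), mul_zero,
          zero_add] at h6
        simp only [zero_mul, zero_add, zero_smul, add_zero]
        linarith
      have h6 := (isLocalMax_profile_line hΓ l1 (Filter.Eventually.of_forall fun τ =>
        hasDerivAt_const τ (1 : ℝ)) l2 (hasDerivAt_const 0 (0 : ℝ)) (by simpa using hWpos)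
        one_pos h5).2
      simpa [hWi] using h6
    have hL0 : deriv Γ (W y) * L ≤ 0 := by
      rw [hL]
      simp only [hWi, mul_zero, Finset.sum_const_zero, sub_zero, Finset.mul_sum]
      exact Finset.sum_nonpos fun l _ => hsec l
    rw [hPt0, ← hP0, Real.zero_rpow (by linarith : σ ≠ 0), hVt, ← hP0]
    have h5 : (p - 1) * W y * (deriv Γ (W y) * L) ≤ 0 :=
      mul_nonpos_of_nonneg_of_nonpos (mul_nonneg (by linarith) hWpos.le) hL0
    linarith
  · -- The gradient does not vanish.
    have hlines := fun l => isLocalMax_profile_line (E := E) (β := β) (σ := σ) hΓ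
      (hline (hW3.of_le (by norm_num)) l).1 (hline hP2 l).1 (hline (hW3.of_le (by norm_num)) l).2
      (hline hP2 l).2 (by simpa using hWpos) (by simpa using hPpos) (hlocmax l)
    simp only [zero_smul, add_zero] at hlines
    set V := W y with hVdef
    set Q := P y with hQdef
    -- Factoring out these powers, which is possible as `V` and `Q` are positive, makes all
    -- derivatives of the profile polynomial in `V` and `Q`.
    set c := E * V ^ (β - 2) * Q ^ (σ - 2) with hc
    have hcpos : 0 < c := by positivity
    have r1 : V ^ (β - 1) = V ^ (β - 2) * V := by
      rw [← Real.rpow_add_one hWpos.ne']; congr 1; ring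
    have r2 : V ^ β = V ^ (β - 2) * V ^ 2 := by
      rw [← Real.rpow_natCast, ← Real.rpow_add hWpos]; congr 1; push_cast; ring
    have r3 : Q ^ (σ - 1) = Q ^ (σ - 2) * Q := by
      rw [← Real.rpow_add_one hPpos.ne']; congr 1; ring
    have r4 : Q ^ σ = Q ^ (σ - 2) * Q ^ 2 := by
      rw [← Real.rpow_natCast, ← Real.rpow_add hPpos]; congr 1; push_cast; ring
    have first : ∀ l, c * (β * V * Q ^ 2 * partialD l W y + s / 2 * V ^ 2 * Q * partialD l P y)
        + deriv Γ V * partialD l W y = 0 := by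
      intro l
      rw [← (hlines l).1, r1, r2, r3, r4, hc]
      ring
    -- Chosen so that the first order condition reads `∇P = 2 lam ∇v`. As `∇P` is twice the Hessian
    -- applied to `∇v`, this is an eigenvalue.
    set lam := -(deriv Γ V + c * β * V * Q ^ 2) / (s * c * V ^ 2 * Q) with hlam
    have hden : s * c * V ^ 2 * Q ≠ 0 := by positivity
    have hlam' : lam * (s * c * V ^ 2 * Q) = -(deriv Γ V + c * β * V * Q ^ 2) :=
      div_mul_cancel₀ _ hden
    have hPl : ∀ l, partialD l P y = 2 * lam * partialD l W y := by
      intro l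
      have h5 : (s * c * V ^ 2 * Q) * (partialD l P y - 2 * lam * partialD l W y) = 0 := by
        linear_combination 2 * first l - 2 * partialD l W y * hlam'
      linarith [(mul_eq_zero.1 h5).resolve_left hden]
    have heig : ∀ i, ∑ j, partialD i (partialD j W) y * partialD j W y
        = lam * partialD i W y := by
      intro i
      have h5 := hPl i
      rw [hP, hNy.partialD_coordGradInner (hW3.of_le (by norm_num)) (hW3.of_le (by norm_num))] at h5
      have h6 : ∑ j, (partialD i (partialD j W) y * partialD j W y
          + partialD j W y * partialD i (partialD j W) y)
          = 2 * ∑ j, partialD i (partialD j W) y * partialD j W y := by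
        rw [Finset.mul_sum]
        exact Finset.sum_congr rfl fun j _ => by ring
      linarith
    set D := ∑ i, partialD i F y * partialD i W y with hD
    have hD0 : m = n → D = 0 := by
      intro hmn
      have hFc : F = fun _ => f t (φ.symm y) := by
        funext z
        exact hfm hmn t ht' _ _
      rw [hD, hFc]
      simp
    have hn' : (2 : ℝ) ≤ n := by exact_mod_cast hn
    have hA := hessian_norm_sq_ge (h := fun i j => partialD i (partialD j W) y) hn hm
      (hPy ▸ hPpos) heig hD0
    rw [← hL] at hA
    have hev := deriv_coordGradInner_le hT hp hg hf hN hu hpos hsol hv hflow hφ ht hy hNy hW hF hP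
      hPt
    have hPF : ∑ l, partialD l W y * partialD l P y = 2 * lam * Q := by
      rw [hPy, Finset.mul_sum]
      exact Finset.sum_congr rfl fun l _ => by rw [hPl]; ring
    rw [hPF] at hev
    have hSx : gradInner (g t) (v t) (fun z => Sigma p N t z V) (φ.symm y)
        = ∑ l, partialD l W y * partialD l (fun z => Sigma p N t (φ.symm z) V) y := by
      rw [gradInner_eq_coordGradInner hφ hy (hvs.mdifferentiableAt (by simp) ht' _)
        (mdifferentiableAt_Sigma hp (hN t htoc) hWpos _), hNy.coordGradInner_eq]
      rfl
    rw [hSx] at h₃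
    set LP := ∑ l, partialD l (partialD l P) y - ∑ l, partialD l F y * partialD l P y with hLP
    have hFP : ∑ l, partialD l F y * partialD l P y = 2 * lam * D := by
      rw [hD, Finset.mul_sum]
      exact Finset.sum_congr rfl fun l _ => by rw [hPl]; ring
    have hΓ₁ : deriv Γ V = -(c * β * V * Q ^ 2 + s * lam * c * V ^ 2 * Q) := by
      linear_combination hlam'
    -- Summing over the coordinate lines gives the plain Laplacian. Replacing it by `Δ_f` is free:
    -- the drift terms in `D` cancel by the first order condition `hΓ₁`.
    have hsecond : c * (β * (β - 1) * Q ^ 3 + 2 * β * s * lam * V * Q ^ 2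
        + s * (s - 2) * lam ^ 2 * V ^ 2 * Q + β * V * Q ^ 2 * L + s / 2 * V ^ 2 * Q * LP)
        + deriv (deriv Γ) V * Q + deriv Γ V * L ≤ 0 := by
      have h5 := Finset.sum_nonpos fun l (_ : l ∈ Finset.univ) => (hlines l).2
      refine le_of_eq_of_le ?_ h5
      have h6 : ∀ l, E * (β * (β - 1) * V ^ (β - 2) * Q ^ σ * partialD l W y ^ 2
          + 2 * β * σ * V ^ (β - 1) * Q ^ (σ - 1) * (partialD l W y * partialD l P y)
          + σ * (σ - 1) * V ^ β * Q ^ (σ - 2) * partialD l P y ^ 2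
          + β * V ^ (β - 1) * Q ^ σ * partialD l (partialD l W) y
          + σ * V ^ β * Q ^ (σ - 1) * partialD l (partialD l P) y)
          + deriv (deriv Γ) V * partialD l W y ^ 2 + deriv Γ V * partialD l (partialD l W) y
          = (c * (β * (β - 1) * Q ^ 2 + 2 * β * s * lam * V * Q + s * (s - 2) * lam ^ 2 * V ^ 2)
              + deriv (deriv Γ) V) * partialD l W y ^ 2
            + (c * (β * V * Q ^ 2) + deriv Γ V) * partialD l (partialD l W) y
            + c * (s / 2 * V ^ 2 * Q) * partialD l (partialD l P) y := by
        intro l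
        rw [hPl, r1, r2, r3, r4, hc, hσ]
        ring
      rw [Finset.sum_congr rfl fun l _ => h6 l, Finset.sum_add_distrib, Finset.sum_add_distrib,
        ← Finset.mul_sum, ← Finset.mul_sum, ← Finset.mul_sum, ← hPy,
        show ∑ l, partialD l (partialD l W) y = L + D by rw [hL]; ring,
        show ∑ l, partialD l (partialD l P) y = LP + 2 * lam * D by rw [hLP, hFP]; ring, hΓ₁]
      ring
    have hfinal := time_derivative_nonpos hs (by linarith : 0 < p - 1) (by linarith : 0 < m - 1)
      (mul_sub_one_le hs (by linarith) hp hp') hβ hWpos hPpos hcpos hVt hev hA hΓ₁ hsecond h₁ h₂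
      h₃ h₄
    refine le_of_eq_of_le ?_ hfinal
    rw [r1, r2, r3, r4, hc, hκ, hσ]
    ring

end Profile

/-! ### The maximum principle -/

/-- Subtracting `δ t` makes the time derivative strictly negative at a spatial maximum. A space-time
maximum of the perturbed function at a positive time would then be exceeded slightly earlier, so the
maximum lies at time `0`. A derivative is needed only at interior times and at spatial maxima. -/
theorem le_of_hasDerivAt_nonpos_at_max {X : Type*} [TopologicalSpace X] [CompactSpace X]
    {T B : ℝ} (hT : 0 < T) {H : ℝ → X → ℝ}
    (hc : ContinuousOn (fun q : ℝ × X => H q.1 q.2) (Set.Icc 0 T ×ˢ Set.univ))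
    (h : ∀ t ∈ Set.Ioo 0 T, ∀ x, (∀ z, H t z ≤ H t x) →
      ∃ d ≤ 0, HasDerivAt (fun τ => H τ x) d t)
    (hB : ∀ y, H 0 y ≤ B) : ∀ t ∈ Set.Icc 0 T, ∀ x, H t x ≤ B := by
  have key : ∀ t ∈ Set.Ioo 0 T, ∀ x, H t x ≤ B := by
    intro t₁ ht₁ x
    refine le_of_forall_pos_le_add fun ε hε => ?_
    -- The perturbation amounts to exactly `ε` at time `t₁`.
    set δ := ε / t₁ with hδ
    have hδpos : 0 < δ := div_pos hε ht₁.1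
    have hcompact : IsCompact (Set.Icc 0 t₁ ×ˢ (Set.univ : Set X)) :=
      isCompact_Icc.prod isCompact_univ
    obtain ⟨⟨t₀, x₀⟩, ⟨ht₀, -⟩, hm⟩ := hcompact.exists_isMaxOn
      (f := fun q : ℝ × X => H q.1 q.2 - δ * q.1)
      ⟨(t₁, x), ⟨ht₁.1.le, le_rfl⟩, Set.mem_univ _⟩
      ((hc.mono (Set.prod_mono (Set.Icc_subset_Icc le_rfl ht₁.2.le) subset_rfl)).sub
        (by fun_prop))
    have hm' : ∀ τ ∈ Set.Icc 0 t₁, ∀ z, H τ z - δ * τ ≤ H t₀ x₀ - δ * t₀ := fun τ hτ z =>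
      hm (show (τ, z) ∈ Set.Icc 0 t₁ ×ˢ (Set.univ : Set X) from ⟨hτ, Set.mem_univ _⟩)
    have hfin := hm' t₁ ⟨ht₁.1.le, le_rfl⟩ x
    have hδt : δ * t₁ = ε := div_mul_cancel₀ _ ht₁.1.ne'
    have ht₀' : 0 ≤ t₀ ∧ t₀ ≤ t₁ := ht₀
    rcases ht₀'.1.eq_or_lt with h0 | h0
    · rw [← h0] at hfin
      have := hB x₀
      linarith
    · exfalso
      obtain ⟨d, hd, hder⟩ := h t₀ ⟨h0, ht₀'.2.trans_lt ht₁.2⟩ x₀ fun z => by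
        have := hm' t₀ ht₀' z
        linarith
      have hder' : HasDerivAt (fun τ => H τ x₀ - δ * τ) (d - δ * 1) t₀ :=
        hder.sub ((hasDerivAt_id t₀).const_mul δ)
      have hs := hasDerivAt_iff_tendsto_slope.1 hder'
      have h1 : ∀ᶠ τ in nhdsWithin t₀ (Set.Iio t₀),
          slope (fun τ => H τ x₀ - δ * τ) t₀ τ < 0 :=
        (hs.mono_left (nhdsLT_le_nhdsNE t₀)).eventually (Iio_mem_nhds (by linarith))
      obtain ⟨τ, hτ1, hτ2⟩ := (h1.and (Ioo_mem_nhdsLT h0)).exists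
      have h2 := hm' τ ⟨hτ2.1.le, hτ2.2.le.trans ht₀'.2⟩ x₀
      rw [slope_def_field] at hτ1
      have h3 : 0 ≤ (H τ x₀ - δ * τ - (H t₀ x₀ - δ * t₀)) / (τ - t₀) :=
        div_nonneg_of_nonpos (by linarith) (by linarith [hτ2.2])
      linarith
  intro t ht x
  rcases ht.1.eq_or_lt with h0 | h0
  · exact h0 ▸ hB x
  rcases ht.2.eq_or_lt with h1 | h1
  · subst h1
    -- The bound at the final time is the limit of the bounds at interior times.
    have hcx : ContinuousOn (fun τ => H τ x) (Set.Icc 0 t) :=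
      hc.comp (f := fun τ : ℝ => (τ, x)) (by fun_prop) fun τ hτ => ⟨hτ, Set.mem_univ _⟩
    have h2 : Filter.Tendsto (fun τ => H τ x) (nhdsWithin t (Set.Ioo 0 t)) (nhds (H t x)) :=
      (hcx t ht).mono_left (nhdsWithin_mono _ Set.Ioo_subset_Icc_self)
    have : (nhdsWithin t (Set.Ioo 0 t)).NeBot := by
      rw [nhdsWithin_Ioo_eq_nhdsLT h0]
      infer_instance
    exact le_of_tendsto h2 (Filter.eventually_of_mem self_mem_nhdsWithin fun τ hτ => key τ hτ x)
  · exact key t ⟨h0, h1⟩ x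

/-- Continuity is local, so it is read off in a chart. The exponent `s/2` is nonnegative, hence
zeros of the gradient cause no trouble. -/
theorem continuousOn_profile {n : ℕ} {M : Type*} [TopologicalSpace M]
    [ChartedSpace (EuclideanSpace ℝ (Fin n)) M] [IsManifold (𝓡 n) ∞ M] {T p s κ : ℝ}
    (hT : 0 < T) (hs : 0 ≤ s) {Γ : ℝ → ℝ} (hΓ : ContinuousOn Γ (Set.Ioi 0))
    {g : ℝ → Metric n M} (hg : MetricC2 T g) {v : ℝ → M → ℝ}
    (hv : SpaceTimeContMDiff n ∞ T v) (hpos : ∀ t ∈ Set.Icc 0 T, ∀ x, 0 < v t x) :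
    ContinuousOn (fun q : ℝ × M => profile p s κ Γ g v q.1 q.2) (Set.Icc 0 T ×ˢ Set.univ) := by
  rintro ⟨t₀, x₀⟩ ⟨ht₀, -⟩
  set φ := chartAt (EuclideanSpace ℝ (Fin n)) x₀ with hφdef
  have hφ : φ ∈ IsManifold.maximalAtlas (𝓡 n) ∞ M := IsManifold.chart_mem_maximalAtlas x₀
  have hx₀ : x₀ ∈ φ.source := mem_chart_source _ x₀
  have hV := (hv.contDiffOn le_rfl hφ).continuousOn
  have hP := (contDiffOn_coordGradInner hT hg hv hφ).continuousOn
  have hK : ContinuousOn (fun q : ℝ × EuclideanSpace ℝ (Fin n) =>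
      profile p s κ Γ g v q.1 (φ.symm q.2)) (Set.Icc 0 T ×ˢ φ.target) := by
    have h1 : ContinuousOn (fun q : ℝ × EuclideanSpace ℝ (Fin n) =>
        Real.exp (-κ * q.1) * (v q.1 (φ.symm q.2) ^ (s / (2 * (s - 1) * (p - 1)))
          * coordGradInner (g q.1) φ (v q.1 ∘ φ.symm) (v q.1 ∘ φ.symm) q.2 ^ (s / 2))
          + Γ (v q.1 (φ.symm q.2))) (Set.Icc 0 T ×ˢ φ.target) := by
      refine ContinuousOn.add (ContinuousOn.mul (by fun_prop) (ContinuousOn.mul ?_ ?_)) ?_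
      · exact hV.rpow_const fun q hq => Or.inl (hpos q.1 hq.1 _).ne'
      · exact hP.rpow_const fun q hq => Or.inr (by linarith)
      · exact hΓ.comp hV fun q hq => hpos q.1 hq.1 _
    refine h1.congr fun q hq => ?_
    rw [profile, weightedGrad_eq, gradInner_eq_coordGradInner hφ hq.2
      (hv.mdifferentiableAt (by simp) hq.1 _) (hv.mdifferentiableAt (by simp) hq.1 _)]
  have h2 : ContinuousOn (fun q : ℝ × M => (q.1, φ q.2)) (Set.Icc 0 T ×ˢ φ.source) :=
    continuousOn_fst.prodMk (φ.continuousOn.comp continuousOn_snd fun q hq => hq.2)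
  have h3 : ContinuousOn (fun q : ℝ × M => profile p s κ Γ g v q.1 q.2)
      (Set.Icc 0 T ×ˢ φ.source) := by
    refine (hK.comp h2 fun q hq => ⟨hq.1, φ.map_source hq.2⟩).congr fun q hq => ?_
    simp only [Function.comp, φ.left_inv hq.2]
  refine (h3 (t₀, x₀) ⟨ht₀, hx₀⟩).mono_of_mem_nhdsWithin ?_
  rw [nhdsWithin_prod_eq, nhdsWithin_univ]
  exact Filter.prod_mem_prod self_mem_nhdsWithin (φ.open_source.mem_nhds hx₀)

end PME

end

/-! ### The gradient estimate -/

theorem corollary10p5 {n : ℕ} (hn : 2 ≤ n)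
    {M : Type*} [TopologicalSpace M] [ChartedSpace (EuclideanSpace ℝ (Fin n)) M]
    [IsManifold (𝓡 n) ∞ M] [T2Space M] [CompactSpace M] [Nonempty M]
    (p s m k a T : ℝ) (hT : 0 < T) (hs : 2 ≤ s) (hm : (n : ℝ) ≤ m)
    (hp : 1 < p) (hp' : p ≤ 1 + 1 / Real.sqrt ((s - 1) * (m - 1)))
    (g : ℝ → PME.Metric n M) (hg : PME.MetricC2 T g)
    (f : ℝ → M → ℝ) (hf : PME.SpaceTimeContMDiff n 2 T f)
    (hfm : m = n → ∀ t ∈ Set.Icc 0 T, ∀ x y : M, f t x = f t y)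
    (N : ℝ → M → ℝ → ℝ)
    (hN : ∀ t ∈ Set.Ioc 0 T,
      ContMDiffOn ((𝓡 n).prod 𝓘(ℝ, ℝ)) 𝓘(ℝ, ℝ) 1
        (fun q : M × ℝ => N t q.1 q.2) (Set.univ ×ˢ Set.Ioi 0))
    (u : ℝ → M → ℝ) (hu : PME.SpaceTimeContMDiff n ∞ T u)
    (hu_pos : ∀ t ∈ Set.Icc 0 T, ∀ x, 0 < u t x)
    (hsol : PME.IsSolution p T g f N u)
    (v : ℝ → M → ℝ) (hv : v = PME.pressure p u)
    (hflow : PME.SuperFlow p m k T g f v)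
    (Γ : ℝ → ℝ) (hΓ : ContDiffOn ℝ 2 Γ (Set.Ioi 0))
    (h₁ : ∀ t ∈ Set.Ioc 0 T, ∀ x : M, deriv Γ (v t x) * PME.Sigma p N t x (v t x) ≤ 0)
    (h₂ : ∀ t ∈ Set.Ioc 0 T, ∀ x : M,
      0 ≤ deriv Γ (v t x) + v t x * deriv (deriv Γ) (v t x))
    (h₃ : ∀ t ∈ Set.Ioc 0 T, ∀ x : M,
      PME.gradInner (g t) (v t) (fun y => PME.Sigma p N t y (v t x)) x ≤ 0)
    (h₄ : ∀ t ∈ Set.Ioc 0 T, ∀ x : M,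
      deriv (PME.Sigma p N t x) (v t x)
        + PME.Sigma p N t x (v t x) / (2 * (s - 1) * (p - 1) * v t x) ≤ a) :
    ∃ B : ℝ,
      IsGreatest (Set.range fun y : M => PME.weightedGrad p s g v 0 y + Γ (v 0 y)) B ∧
      ∀ x : M, ∀ t ∈ Set.Ioc 0 T,
        PME.weightedGrad p s g v t x ≤ Real.exp (s * (k + a) * t) * (B - Γ (v t x)) := by
  have hvs : PME.SpaceTimeContMDiff n ∞ T v := hv ▸ hu.pressure hu_pos
  have hvpos : ∀ t ∈ Set.Icc 0 T, ∀ x, 0 < v t x := fun t ht x => by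
    rw [hv]
    exact PME.pressure_pos hp (hu_pos t ht x)
  have hc := PME.continuousOn_profile (p := p) (κ := s * (k + a)) hT (by linarith : 0 ≤ s)
    hΓ.continuousOn hg hvs hvpos
  have h0 : ∀ y, PME.profile p s (s * (k + a)) Γ g v 0 y
      = PME.weightedGrad p s g v 0 y + Γ (v 0 y) := fun y => by simp [PME.profile]
  have hc0 : Continuous fun y : M => PME.weightedGrad p s g v 0 y + Γ (v 0 y) := by
    simp only [← h0]
    exact hc.comp_continuous (f := fun y : M => ((0 : ℝ), y)) (by fun_prop) fun y =>
      ⟨⟨le_rfl, hT.le⟩, Set.mem_univ _⟩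
  obtain ⟨B, hB⟩ := (isCompact_range hc0).exists_isGreatest (Set.range_nonempty _)
  refine ⟨B, hB, fun x t ht => ?_⟩
  -- At time `0` the exponential weight is `1`, so the initial bound for the profile is precisely
  -- `B`.
  have hle := PME.le_of_hasDerivAt_nonpos_at_max hT hc
    (fun t ht x hmax => by
      have ht2 : t ∈ Set.Ioc 0 T := ⟨ht.1, ht.2.le⟩
      exact PME.exists_hasDerivAt_profile_nonpos hn hT hs hm hp hp' hg hf hfm hN hu hu_pos hsol hv
        hflow hΓ ht (h₁ t ht2 x) (h₂ t ht2 x) (h₃ t ht2 x) (h₄ t ht2 x) hmax)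
    (fun y => (h0 y).trans_le (hB.2 ⟨y, rfl⟩)) t ⟨ht.1.le, ht.2⟩ x
  have hexp : Real.exp (s * (k + a) * t) * Real.exp (-(s * (k + a)) * t) = 1 := by
    rw [← Real.exp_add, ← Real.exp_zero]
    congr 1
    ring
  rw [PME.profile] at hle
  calc PME.weightedGrad p s g v t x
      = Real.exp (s * (k + a) * t)
        * (Real.exp (-(s * (k + a)) * t) * PME.weightedGrad p s g v t x) := by
        rw [← mul_assoc, hexp, one_mul]
    _ ≤ Real.exp (s * (k + a) * t) * (B - Γ (v t x)) :=
        mul_le_mul_of_nonneg_left (by linarith) (Real.exp_pos _).le
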